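/- Let $p\in(1,\infty)$, $\mu\in\mathbb R$ and $s_1,\dots,s_N\in\mathbb R$. Write $\langle\xi\rangle=(1+|\xi|^2)^{1/2}$ and $\mathscr F\varphi(\xi)=(2\pi)^{-n/2}\int_{\mathbb R^n}e^{ix\cdot\xi}\varphi(x)\,dx$, extended to tempered distributions, and $\operatorname{op}[m]=\mathscr F^{-1}m\mathscr F$. Let $a\in S^\mu(\mathbb R^n;\mathbb C^{N\times N})$, i.e. $a$ is smooth and for every multi-index $\alpha$ there is $C_\alpha$ with $|\partial^\alpha a(\xi)|\le C_\alpha\langle\xi\rangle^{\mu-|\alpha|}$ for all $\xi\in\mathbb R^n$. Assume that $a$ is quasi-hyperbolic: there is $M\in\mathbb R$ such that $\det(\lambda-a(\xi))\ne0$ for all $\xi\in\mathbb R^n$ and all $\lambda\in\mathbb C$ with $\operatorname{Re}\lambda>M$. For $s\in\mathbb R$ let $H_p^s(\mathbb R^n)=\{u\in\mathscr S'(\mathbb R^n):\operatorname{op}[\langle\cdot\rangle^s]u\in L^p(\mathbb R^n)\}$ with norm $\|\operatorname{op}[\langle\cdot\rangle^s]u\|_{L^p}$. In a product $X$ of such spaces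 let $A$ be the closed, densely defined operator $Au=\operatorname{op}[a]u$ with domain $D(A)=\{u\in X:\operatorname{op}[a]u\in X\}$. The Cauchy problem $\partial_tu-Au=0$ $(t>0)$, $u(0)=u_0$, is called well-posed in $X$ if for every $u_0\in D(A)$ there is a unique $u\in C^1([0,\infty),X)$ with $u(t)\in D(A)$ for $t>0$ that solves it, and if for every $T>0$ there is $C_T>0$ such that $\|u(t)\|_X\le C_T\|u_0\|_X$ for all $t\in[0,T]$ and all $u_0\in D(A)$. Let $M_p^N$ be the space of $L^p$-Fourier multipliers, i.e. of all $m\in L^\infty(\mathbb R^n;\mathbb C^{N\times N})$ for which $\operatorname{op}[m]$ maps $\mathscr S(\mathbb R^n;\mathbb C^N)$ into $L^p(\mathbb R^n;\mathbb C^N)$ and is bounded there with respect to the $L^p$-norm, and let $\|m\|_{M_p^N}$ be the norm of the continuous extension of $\operatorname{op}[m]$ in $L(L^p(\mathbb R^n;\mathbb C^N))$. Then the following statements are equivalent: (i) The Cauchy problem is well-posed in $X=\prod_{j=1}^N H_p^{s_j}(\mathbb R^n)$. (ii) Let $\Lambda(\xi)=\operatorname{diag}(\langle\xi\rangle^{s_1},\dots,\langle\xi\rangle^{s_N})$.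 For every $T\ge0$ there is $C_T>0$ such that for all $t\in[0,T]$ one has $\Lambda e^{ta(\cdot)}\Lambda^{-1}\in M_p^N$ and $\|\Lambda e^{ta(\cdot)}\Lambda^{-1}\|_{M_p^N}\le C_T$. (iii) For every $s\in\mathbb R$, the Cauchy problem is well-posed in $X=\prod_{j=1}^N H_p^{s_j+s}(\mathbb R^n)$. -/

import Mathlib

open MeasureTheory Matrix Set
open scoped ENNReal SchwartzMap FourierTransform ContDiff

noncomputable section

namespace MixedOrder

/-- `ℝⁿ` with its Euclidean norm. -/
abbrev Rn (n : ℕ) : Type := EuclideanSpace ℝ (Fin n)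

/-- `⟨ξ⟩ = (1 + |ξ|²)^{1/2}`. -/
def bracket {n : ℕ} (ξ : Rn n) : ℝ := Real.sqrt (1 + ‖ξ‖ ^ 2)

/-- The scalar symbol class `S^μ(ℝⁿ) = S^μ_{1,0}(ℝⁿ)` of `x`-independent symbols: smooth functions
whose derivatives of order `k` are `O(⟨ξ⟩^{μ-k})`, uniformly on `ℝⁿ`.  (The norm of the `k`-th
Fréchet derivative is equivalent to the maximum of `|∂^α b|` over `|α| = k`.) -/
def IsSymbol {n : ℕ} (μ : ℝ) (b : Rn n → ℂ) : Prop :=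
  ContDiff ℝ ∞ b ∧ ∀ k : ℕ, ∃ C : ℝ, ∀ ξ : Rn n,
    ‖iteratedFDeriv ℝ k b ξ‖ ≤ C * bracket ξ ^ (μ - (k : ℝ))

/-- The matrix-valued symbol class `S^μ(ℝⁿ; ℂ^{N×N})`. -/
def IsMatrixSymbol {n N : ℕ} (μ : ℝ) (a : Rn n → Matrix (Fin N) (Fin N) ℂ) : Prop :=
  ∀ i j, IsSymbol μ (fun ξ => a ξ i j)

/-- Quasi-hyperbolicity (the Petrovskii condition): for some real `M`, all eigenvalues of all the
matrices `a(ξ)` have real part at most `M`. -/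
def IsQuasiHyperbolic {n N : ℕ} (a : Rn n → Matrix (Fin N) (Fin N) ℂ) : Prop :=
  ∃ M : ℝ, ∀ z : ℂ, M < z.re → ∀ ξ : Rn n,
    (z • (1 : Matrix (Fin N) (Fin N) ℂ) - a ξ).det ≠ 0

/-! ### Pseudodifferential operators on tempered distributions

The Fourier transform is normalized as `(ℱφ)(ξ) = (2π)^{-n/2} ∫ e^{i x·ξ} φ(x) dx`, whereas Mathlib
uses `(𝓕 φ)(η) = ∫ e^{-2πi x·η} φ(x) dx`.  Hence `(ℱφ)(-2πη) = (2π)^{-n/2} (𝓕 φ)(η)`, and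
`ℱ⁻¹ m ℱ = 𝓕⁻¹ m(-2π ·) 𝓕` for every multiplier `m`. -/

/-- The substitution `m ↦ m(-2π ·)`, which translates multipliers from `ℱ` to Mathlib's `𝓕`. -/
def rescale {n : ℕ} {α : Type*} (m : Rn n → α) : Rn n → α := fun η => m ((-(2 * Real.pi)) • η)

/-- The scalar operator `op[m] = ℱ⁻¹ m ℱ` on `𝓢'(ℝⁿ)`, for `m` smooth and slowly increasing. -/
def op {n : ℕ} (m : Rn n → ℂ) : 𝓢'(Rn n, ℂ) →L[ℂ] 𝓢'(Rn n, ℂ) :=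
  TemperedDistribution.fourierMultiplierCLM ℂ (rescale m)

/-- The system `op[a]` on `𝓢'(ℝⁿ; ℂᴺ) = 𝓢'(ℝⁿ)ᴺ`: `(op[a] u)ᵢ = ∑ⱼ op[aᵢⱼ] uⱼ`. -/
def opSystem {n N : ℕ} (a : Rn n → Matrix (Fin N) (Fin N) ℂ) :
    (Fin N → 𝓢'(Rn n, ℂ)) →ₗ[ℂ] (Fin N → 𝓢'(Rn n, ℂ)) :=
  LinearMap.pi fun i => ∑ j, (op (fun ξ => a ξ i j)).toLinearMap ∘ₗ LinearMap.proj j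

/-! ### Bessel potential spaces -/

/-- The embedding of `Lᵖ(ℝⁿ)` into `𝓢'(ℝⁿ)`. -/
def lpEmb (n : ℕ) (p : ℝ≥0∞) [Fact (1 ≤ p)] : Lp ℂ p (volume : Measure (Rn n)) →ₗ[ℂ] 𝓢'(Rn n, ℂ) :=
  (Lp.toTemperedDistributionCLM ℂ (volume : Measure (Rn n)) p).toLinearMap

theorem lpEmb_injective (n : ℕ) (p : ℝ≥0∞) [Fact (1 ≤ p)] : Function.Injective (lpEmb n p) :=
  LinearMap.ker_eq_bot.mp Lp.ker_toTemperedDistributionCLM_eq_bot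

/-- The Bessel potential `op[⟨·⟩^s]` on `𝓢'(ℝⁿ)`. -/
def bessel (n : ℕ) (s : ℝ) : 𝓢'(Rn n, ℂ) →L[ℂ] 𝓢'(Rn n, ℂ) :=
  op fun ξ => ((bracket ξ ^ s : ℝ) : ℂ)

/-- `{u ∈ 𝓢'(ℝⁿ) : op[⟨·⟩^s] u ∈ Lᵖ(ℝⁿ)}` as a subspace of `𝓢'(ℝⁿ)`. -/
def besselSubmodule (n : ℕ) (p : ℝ≥0∞) [Fact (1 ≤ p)] (s : ℝ) : Submodule ℂ 𝓢'(Rn n, ℂ) :=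
  (LinearMap.range (lpEmb n p)).comap (bessel n s).toLinearMap

/-- The Bessel potential space `H_p^s(ℝⁿ)`.  A type of its own, since it carries the norm
`‖u‖ = ‖op[⟨·⟩^s] u‖_{Lᵖ}` and not the topology of `𝓢'(ℝⁿ)`. -/
def BesselSpace (n : ℕ) (p : ℝ≥0∞) [Fact (1 ≤ p)] (s : ℝ) : Type := besselSubmodule n p s

namespace BesselSpace

variable {n : ℕ} {p : ℝ≥0∞} [Fact (1 ≤ p)] {s : ℝ}

instance : AddCommGroup (BesselSpace n p s) := inferInstanceAs (AddCommGroup (besselSubmodule n p s))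

instance : Module ℂ (BesselSpace n p s) := inferInstanceAs (Module ℂ (besselSubmodule n p s))

/-- The inclusion `H_p^s(ℝⁿ) ⊆ 𝓢'(ℝⁿ)`. -/
def toDist : BesselSpace n p s →ₗ[ℂ] 𝓢'(Rn n, ℂ) := (besselSubmodule n p s).subtype

/-- The map `u ↦ op[⟨·⟩^s] u` from `H_p^s(ℝⁿ)` to `Lᵖ(ℝⁿ)`. -/
def toLp : BesselSpace n p s →ₗ[ℂ] Lp ℂ p (volume : Measure (Rn n)) :=
  (LinearEquiv.ofInjective (lpEmb n p) (lpEmb_injective n p)).symm.toLinearMap ∘ₗ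
    ((bessel n s).toLinearMap ∘ₗ toDist).codRestrict (LinearMap.range (lpEmb n p)) fun u => u.2

theorem lpEmb_toLp (u : BesselSpace n p s) : lpEmb n p (toLp u) = bessel n s (toDist u) := by
  have h := LinearEquiv.ofInjective_apply (lpEmb n p) (h := lpEmb_injective n p) (toLp u)
  rw [← h, toLp, LinearMap.comp_apply, LinearEquiv.coe_coe, LinearEquiv.apply_symm_apply]
  rfl

end BesselSpace

theorem bracket_pos {n : ℕ} (ξ : Rn n) : 0 < bracket ξ := Real.sqrt_pos.mpr (by positivity)

theorem rescale_hasTemperateGrowth {n : ℕ} {m : Rn n → ℂ} (hm : m.HasTemperateGrowth) :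
    (rescale m).HasTemperateGrowth := by
  have h : (fun η : Rn n => (-(2 * Real.pi)) • η).HasTemperateGrowth := by fun_prop
  exact hm.comp h

theorem bracket_rpow_hasTemperateGrowth (n : ℕ) (s : ℝ) :
    (fun ξ : Rn n => ((bracket ξ ^ s : ℝ) : ℂ)).HasTemperateGrowth := by
  have h : (fun ξ : Rn n => (bracket ξ ^ s : ℝ)) = fun ξ => (1 + ‖ξ‖ ^ 2) ^ (s / 2) := by
    funext ξ
    rw [bracket, Real.sqrt_eq_rpow, ← Real.rpow_mul (by positivity)]
    congr 1; ring
  have h2 : (fun ξ : Rn n => (((1 + ‖ξ‖ ^ 2) ^ (s / 2) : ℝ) : ℂ)).HasTemperateGrowth := by fun_prop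
  have := congrArg (fun f : Rn n → ℝ => fun ξ => ((f ξ : ℝ) : ℂ)) h
  simpa only [this] using h2

theorem rescale_bracket_mul (n : ℕ) (s : ℝ) :
    (rescale (fun ξ : Rn n => ((bracket ξ ^ (-s) : ℝ) : ℂ)) *
      rescale fun ξ : Rn n => ((bracket ξ ^ s : ℝ) : ℂ)) = fun _ => 1 := by
  funext η
  have := (Real.rpow_pos_of_pos (bracket_pos ((-(2 * Real.pi)) • η)) s).ne'
  simp only [rescale, Pi.mul_apply, ← Complex.ofReal_mul,
    Real.rpow_neg (bracket_pos _).le, inv_mul_cancel₀ this, Complex.ofReal_one]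

theorem bessel_neg_bessel {n : ℕ} (s : ℝ) (u : 𝓢'(Rn n, ℂ)) :
    bessel n (-s) (bessel n s u) = u := by
  have h := TemperedDistribution.fourierMultiplierCLM_fourierMultiplierCLM_apply (F := ℂ)
    (rescale_hasTemperateGrowth (bracket_rpow_hasTemperateGrowth n s))
    (rescale_hasTemperateGrowth (bracket_rpow_hasTemperateGrowth n (-s))) u
  rw [mul_comm, rescale_bracket_mul] at h
  simpa [bessel, op] using h

theorem bessel_bessel_neg {n : ℕ} (s : ℝ) (u : 𝓢'(Rn n, ℂ)) :
    bessel n s (bessel n (-s) u) = u := by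
  simpa using bessel_neg_bessel (-s) u

namespace BesselSpace

variable {n : ℕ} {p : ℝ≥0∞} [Fact (1 ≤ p)] {s : ℝ}

theorem toDist_eq (u : BesselSpace n p s) : toDist u = bessel n (-s) (lpEmb n p (toLp u)) := by
  rw [lpEmb_toLp, bessel_neg_bessel]

theorem toDist_injective : Function.Injective (toDist (n := n) (p := p) (s := s)) :=
  Subtype.val_injective

theorem toLp_injective : Function.Injective (toLp (n := n) (p := p) (s := s)) := by
  intro u v h
  apply toDist_injective
  rw [toDist_eq, toDist_eq, h]

theorem toLp_surjective : Function.Surjective (toLp (n := n) (p := p) (s := s)) := by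
  intro f
  refine ⟨⟨bessel n (-s) (lpEmb n p f), f, ?_⟩, ?_⟩
  · exact (bessel_bessel_neg s _).symm
  · apply lpEmb_injective
    exact (lpEmb_toLp _).trans (bessel_bessel_neg s _)

/-- The canonical norm of `H_p^s(ℝⁿ)`: `‖u‖ = ‖op[⟨·⟩^s] u‖_{Lᵖ}`. -/
instance : NormedAddCommGroup (BesselSpace n p s) :=
  NormedAddCommGroup.induced _ _ toLp toLp_injective

theorem norm_eq (u : BesselSpace n p s) : ‖u‖ = ‖toLp u‖ := rfl

instance : NormedSpace ℂ (BesselSpace n p s) where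
  norm_smul_le c u := by rw [norm_eq, norm_eq, map_smul, norm_smul]

/-- `op[⟨·⟩^s] : H_p^s(ℝⁿ) → Lᵖ(ℝⁿ)` is an isometric isomorphism. -/
def toLpEquiv : BesselSpace n p s ≃ₗᵢ[ℂ] Lp ℂ p (volume : Measure (Rn n)) where
  toLinearEquiv := LinearEquiv.ofBijective toLp ⟨toLp_injective, toLp_surjective⟩
  norm_map' _ := rfl

instance : CompleteSpace (BesselSpace n p s) :=
  (toLpEquiv (n := n) (p := p) (s := s)).toIsometryEquiv.completeSpace

theorem toDist_continuous : Continuous (toDist (n := n) (p := p) (s := s)) := by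
  have h : (toDist (n := n) (p := p) (s := s) : BesselSpace n p s → 𝓢'(Rn n, ℂ)) =
      fun u => bessel n (-s) (Lp.toTemperedDistributionCLM ℂ volume p (toLpEquiv u)) :=
    funext toDist_eq
  rw [h]
  fun_prop

end BesselSpace

/-! ### The realization of `op[a]` in `X = ∏ⱼ H_p^{sⱼ}(ℝⁿ)` -/

/-- The Banach space `X = ∏ⱼ H_p^{sⱼ}(ℝⁿ)` with the product norm. -/
abbrev BesselProd (n : ℕ) (p : ℝ≥0∞) [Fact (1 ≤ p)] {N : ℕ} (s : Fin N → ℝ) : Type :=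
  ∀ j, BesselSpace n p (s j)

/-- The inclusion `X ⊆ 𝓢'(ℝⁿ; ℂᴺ)`. -/
def prodToDist {n : ℕ} {p : ℝ≥0∞} [Fact (1 ≤ p)] {N : ℕ} {s : Fin N → ℝ} :
    BesselProd n p s →ₗ[ℂ] (Fin N → 𝓢'(Rn n, ℂ)) :=
  LinearMap.pi fun j => BesselSpace.toDist ∘ₗ LinearMap.proj j

theorem prodToDist_injective {n : ℕ} {p : ℝ≥0∞} [Fact (1 ≤ p)] {N : ℕ} {s : Fin N → ℝ} :
    Function.Injective (prodToDist (n := n) (p := p) (s := s)) := fun _ _ h =>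
  funext fun j => BesselSpace.toDist_injective (congrFun h j)

/-- The operator `A = op[a]` in `X` with maximal domain `D(A) = {u ∈ X : op[a] u ∈ X}`. -/
def realization {n N : ℕ} (p : ℝ≥0∞) [Fact (1 ≤ p)] (s : Fin N → ℝ)
    (a : Rn n → Matrix (Fin N) (Fin N) ℂ) : BesselProd n p s →ₗ.[ℂ] BesselProd n p s where
  domain := (LinearMap.range (prodToDist (n := n) (p := p) (s := s))).comap
    (opSystem a ∘ₗ prodToDist)
  toFun := (LinearEquiv.ofInjective prodToDist prodToDist_injective).symm.toLinearMap ∘ₗ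
    (opSystem a ∘ₗ prodToDist).restrict fun _ hu => hu

/-- `A u = op[a] u` for `u ∈ D(A)`. -/
theorem prodToDist_realization {n N : ℕ} {p : ℝ≥0∞} [Fact (1 ≤ p)] {s : Fin N → ℝ}
    {a : Rn n → Matrix (Fin N) (Fin N) ℂ} (u : (realization p s a).domain) :
    prodToDist (realization p s a u) = opSystem a (prodToDist (u : BesselProd n p s)) := by
  have h := LinearEquiv.ofInjective_apply (prodToDist (n := n) (p := p) (s := s))
    (h := prodToDist_injective) (realization p s a u)
  rw [← h]
  exact congrArg Subtype.val
    ((LinearEquiv.ofInjective prodToDist prodToDist_injective).apply_symm_apply _)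

theorem prodToDist_continuous {n : ℕ} {p : ℝ≥0∞} [Fact (1 ≤ p)] {N : ℕ} {s : Fin N → ℝ} :
    Continuous (prodToDist (n := n) (p := p) (s := s)) :=
  continuous_pi fun j => BesselSpace.toDist_continuous.comp (continuous_apply j)

theorem opSystem_continuous {n N : ℕ} (a : Rn n → Matrix (Fin N) (Fin N) ℂ) :
    Continuous (opSystem a) := by
  refine continuous_pi fun i => ?_
  have h : (fun u : Fin N → 𝓢'(Rn n, ℂ) => opSystem a u i) =
      fun u => ∑ j, op (fun ξ => a ξ i j) (u j) := by
    funext u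
    simp [opSystem]
  rw [h]
  fun_prop

theorem realization_isClosed {n N : ℕ} (p : ℝ≥0∞) [Fact (1 ≤ p)] (s : Fin N → ℝ)
    (a : Rn n → Matrix (Fin N) (Fin N) ℂ) : (realization p s a).IsClosed := by
  have h : ((realization p s a).graph : Set (BesselProd n p s × BesselProd n p s)) =
      {z | prodToDist z.2 = opSystem a (prodToDist z.1)} := by
    ext ⟨u, v⟩
    simp only [SetLike.mem_coe, LinearPMap.mem_graph_iff, mem_ofPred_eq]
    constructor
    · rintro ⟨y, rfl, rfl⟩
      exact prodToDist_realization y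
    · intro h
      refine ⟨⟨u, v, h⟩, rfl, prodToDist_injective ?_⟩
      exact (prodToDist_realization _).trans h.symm
  rw [LinearPMap.IsClosed, h]
  exact isClosed_eq (prodToDist_continuous.comp continuous_snd)
    ((opSystem_continuous a).comp (prodToDist_continuous.comp continuous_fst))

theorem IsSymbol.hasTemperateGrowth {n : ℕ} {μ : ℝ} {b : Rn n → ℂ} (hb : IsSymbol μ b) :
    b.HasTemperateGrowth := by
  refine ⟨hb.1, fun k => ?_⟩
  obtain ⟨C, hC⟩ := hb.2 k
  obtain ⟨K, hK⟩ := exists_nat_ge (μ - k)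
  refine ⟨K, |C|, fun ξ => (hC ξ).trans ?_⟩
  have h1 : 1 ≤ bracket ξ := by
    rw [bracket, Real.one_le_sqrt]
    nlinarith [norm_nonneg ξ]
  have h2 : bracket ξ ≤ 1 + ‖ξ‖ := by
    rw [bracket, Real.sqrt_le_left (by positivity)]
    nlinarith [norm_nonneg ξ]
  have h3 : bracket ξ ^ (μ - (k : ℝ)) ≤ (1 + ‖ξ‖) ^ K :=
    (Real.rpow_le_rpow_of_exponent_le h1 hK).trans <| by
      rw [Real.rpow_natCast]
      gcongr
  have h4 : 0 ≤ bracket ξ ^ (μ - (k : ℝ)) := by positivity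
  exact mul_le_mul (le_abs_self C) h3 h4 (abs_nonneg C)

theorem op_schwartz {n : ℕ} {m : Rn n → ℂ} (hm : m.HasTemperateGrowth) (φ : 𝓢(Rn n, ℂ)) :
    op m (φ : 𝓢'(Rn n, ℂ)) = (SchwartzMap.fourierMultiplierCLM ℂ (rescale m) φ : 𝓢(Rn n, ℂ)) :=
  TemperedDistribution.fourierMultiplierCLM_toTemperedDistributionCLM_eq
    (rescale_hasTemperateGrowth hm) φ

/-- Schwartz functions, as elements of `H_p^s(ℝⁿ)`. -/
def schwartzToBessel {n : ℕ} (p : ℝ≥0∞) [Fact (1 ≤ p)] (s : ℝ) (φ : 𝓢(Rn n, ℂ)) :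
    BesselSpace n p s :=
  ⟨(φ : 𝓢'(Rn n, ℂ)),
    (SchwartzMap.fourierMultiplierCLM ℂ
      (rescale fun ξ : Rn n => ((bracket ξ ^ s : ℝ) : ℂ)) φ).toLp p, by
      change Lp.toTemperedDistribution _ = op _ _
      rw [op_schwartz (bracket_rpow_hasTemperateGrowth n s), Lp.toTemperedDistribution_toLp_eq]⟩

theorem toLp_schwartzToBessel {n : ℕ} (p : ℝ≥0∞) [Fact (1 ≤ p)] (s : ℝ) (φ : 𝓢(Rn n, ℂ)) :
    BesselSpace.toLp (schwartzToBessel p s φ) = (SchwartzMap.fourierMultiplierCLM ℂ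
      (rescale fun ξ : Rn n => ((bracket ξ ^ s : ℝ) : ℂ)) φ).toLp p := by
  apply lpEmb_injective
  rw [BesselSpace.lpEmb_toLp]
  change op _ (φ : 𝓢'(Rn n, ℂ)) = Lp.toTemperedDistribution _
  rw [op_schwartz (bracket_rpow_hasTemperateGrowth n s), Lp.toTemperedDistribution_toLp_eq]

theorem denseRange_schwartzToBessel {n : ℕ} {p : ℝ≥0∞} [Fact (1 ≤ p)] (hp : p ≠ ⊤) (s : ℝ) :
    DenseRange (schwartzToBessel (n := n) p s) := by
  have h : DenseRange fun φ : 𝓢(Rn n, ℂ) => φ.toLp p (volume : Measure (Rn n)) :=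
    SchwartzMap.denseRange_toLpCLM hp
  have h1 := (BesselSpace.toLpEquiv (n := n) (p := p) (s := s)).symm.surjective.denseRange.comp h
    (BesselSpace.toLpEquiv (n := n) (p := p) (s := s)).symm.continuous
  refine h1.mono ?_
  rintro _ ⟨φ, rfl⟩
  refine ⟨SchwartzMap.fourierMultiplierCLM ℂ
    (rescale fun ξ : Rn n => ((bracket ξ ^ (-s) : ℝ) : ℂ)) φ, ?_⟩
  rw [Function.comp_apply, LinearIsometryEquiv.eq_symm_apply]
  refine (toLp_schwartzToBessel p s _).trans ?_
  rw [SchwartzMap.fourierMultiplierCLM_fourierMultiplierCLM_apply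
    (rescale_hasTemperateGrowth (bracket_rpow_hasTemperateGrowth n s))
    (rescale_hasTemperateGrowth (bracket_rpow_hasTemperateGrowth n (-s))), mul_comm,
    rescale_bracket_mul]
  simp

theorem realization_dense {n N : ℕ} {p : ℝ≥0∞} [Fact (1 ≤ p)] (hp : p ≠ ⊤) (s : Fin N → ℝ)
    {μ : ℝ} {a : Rn n → Matrix (Fin N) (Fin N) ℂ} (ha : IsMatrixSymbol μ a) :
    Dense ((realization p s a).domain : Set (BesselProd n p s)) := by
  have h : DenseRange fun (φ : Fin N → 𝓢(Rn n, ℂ)) (j : Fin N) => schwartzToBessel p (s j) (φ j) :=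
    DenseRange.piMap fun j => denseRange_schwartzToBessel hp (s j)
  refine h.mono ?_
  rintro _ ⟨φ, rfl⟩
  refine ⟨fun i => schwartzToBessel p (s i)
    (∑ j, SchwartzMap.fourierMultiplierCLM ℂ (rescale fun ξ => a ξ i j) (φ j)), ?_⟩
  funext i
  change SchwartzMap.toTemperedDistributionCLM (Rn n) ℂ volume _ =
    (∑ j, (op (fun ξ => a ξ i j)).toLinearMap ∘ₗ LinearMap.proj j)
      (fun j => SchwartzMap.toTemperedDistributionCLM (Rn n) ℂ volume (φ j))
  simp [op_schwartz (ha i _).hasTemperateGrowth]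

/-! ### Well-posedness of the Cauchy problem in a Banach space -/

section WellPosed

variable {X : Type*} [NormedAddCommGroup X] [NormedSpace ℂ X]

/-- `u` (restricted to `[0, ∞)`) is a classical solution of `∂ₜ u - A u = 0` for `t > 0`,
`u(0) = u₀`: it belongs to `C¹([0, ∞), X)`, and `u(t) ∈ D(A)`, `u'(t) = A u(t)` for `t > 0`. -/
structure IsClassicalSolution (A : X →ₗ.[ℂ] X) (u₀ : X) (u : ℝ → X) : Prop where
  contDiffOn : ContDiffOn ℝ 1 u (Ici 0)
  initial : u 0 = u₀
  equation : ∀ t : ℝ, 0 < t → ∃ h : u t ∈ A.domain, HasDerivAt u (A ⟨u t, h⟩) t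

/-- Well-posedness of the Cauchy problem for a closed, densely defined operator `A` in the Banach
space `X`: for all initial values in `D(A)` there is a unique classical solution on `[0, ∞)`, and
the solutions depend continuously on the initial values, uniformly on compact time intervals.
For the operators `realization p s a` with `a` a symbol and `p < ∞`, the first two fields hold
automatically, by `realization_isClosed` and `realization_dense`. -/
structure IsWellPosed [CompleteSpace X] (A : X →ₗ.[ℂ] X) : Prop where
  closed : A.IsClosed
  dense : Dense (A.domain : Set X)
  existence : ∀ u₀ ∈ A.domain, ∃ u : ℝ → X, IsClassicalSolution A u₀ u
  uniqueness : ∀ u₀ ∈ A.domain, ∀ u v : ℝ → X,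
    IsClassicalSolution A u₀ u → IsClassicalSolution A u₀ v → EqOn u v (Ici 0)
  estimate : ∀ T : ℝ, 0 < T → ∃ C : ℝ, 0 < C ∧ ∀ u₀ ∈ A.domain, ∀ u : ℝ → X,
    IsClassicalSolution A u₀ u → ∀ t ∈ Icc 0 T, ‖u t‖ ≤ C * ‖u₀‖

end WellPosed

/-! ### Fourier multipliers on `Lᵖ(ℝⁿ; ℂᴺ)` -/

/-- `ℂᴺ` with its Euclidean norm. -/
abbrev CN (N : ℕ) : Type := EuclideanSpace ℂ (Fin N)

/-- `op[m] u = ℱ⁻¹ m ℱ u` for `m ∈ L^∞(ℝⁿ; ℂ^{N×N})` and `u ∈ 𝓢(ℝⁿ; ℂᴺ)`.  Here `m ℱ u` is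
integrable, so that the inverse Fourier transform is given by an absolutely convergent integral. -/
def multiplierOp {n N : ℕ} (m : Rn n → Matrix (Fin N) (Fin N) ℂ) (u : 𝓢(Rn n, CN N)) :
    Rn n → CN N :=
  𝓕⁻ fun η : Rn n => WithLp.toLp 2 (rescale m η *ᵥ (𝓕 u η).ofLp)

/-- `c ≥ 0` bounds `op[m]` on the Schwartz space with respect to the norm of `Lᵖ(ℝⁿ; ℂᴺ)`. -/
def IsMultiplierBound {n N : ℕ} (p : ℝ≥0∞) (m : Rn n → Matrix (Fin N) (Fin N) ℂ) (c : ℝ) : Prop :=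
  0 ≤ c ∧ ∀ u : 𝓢(Rn n, CN N), MemLp (multiplierOp m u) p ∧
    eLpNorm (multiplierOp m u) p ≤ ENNReal.ofReal c * eLpNorm u p

/-- `m ∈ M_p^N`: `m ∈ L^∞(ℝⁿ; ℂ^{N×N})` is an `Lᵖ`-Fourier multiplier. -/
def IsMultiplier {n N : ℕ} (p : ℝ≥0∞) (m : Rn n → Matrix (Fin N) (Fin N) ℂ) : Prop :=
  (∀ i j, MemLp (fun ξ => m ξ i j) ⊤) ∧ ∃ c, IsMultiplierBound p m c

/-- The norm of `m ∈ M_p^N`, i.e. the operator norm of the extension of `op[m]` by continuity from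
the dense subspace `𝓢(ℝⁿ; ℂᴺ)` to `Lᵖ(ℝⁿ; ℂᴺ)`.  To be used together with `IsMultiplier p m`. -/
def multiplierNorm {n N : ℕ} (p : ℝ≥0∞) (m : Rn n → Matrix (Fin N) (Fin N) ℂ) : ℝ :=
  sInf {c | IsMultiplierBound p m c}

/-- `Λ(ξ) = diag(⟨ξ⟩^{s₁}, …, ⟨ξ⟩^{s_N})`. -/
def weight {n N : ℕ} (s : Fin N → ℝ) (ξ : Rn n) : Matrix (Fin N) (Fin N) ℂ :=
  Matrix.diagonal fun j => ((bracket ξ ^ s j : ℝ) : ℂ)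

/-- The symbol `Λ e^{t a(·)} Λ⁻¹`. -/
def conjugatedExp {n N : ℕ} (s : Fin N → ℝ) (a : Rn n → Matrix (Fin N) (Fin N) ℂ) (t : ℝ)
    (ξ : Rn n) : Matrix (Fin N) (Fin N) ℂ :=
  weight s ξ * NormedSpace.exp ((t : ℂ) • a ξ) * (weight s ξ)⁻¹

end MixedOrder

end

/-! Frequency cutoffs reduce the unbounded operator to bounded ones. Let `χ_k` be the dyadic cutoff,
`P_k = op[χ_k]` and `B_k = op[χ_{k+1} a]`. Both are bounded on `X` and commute, `P_k` tends strongly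
to the identity, and `A = B_k` on the range of `P_k`, because `χ_{k+1} = 1` on the support of `χ_k`.
Hence `e^{tB_k} P_k x` is a classical solution with initial value `P_k x`. Conversely, `P_k` maps
every classical solution `u` to `e^{tB_k} P_k u(0)`. So well-posedness amounts to a bound for
`e^{tB_k} P_k` that is uniform in `k` and in `t ∈ [0, T]`: uniqueness and the estimate follow by
letting `k → ∞` in `P_k u(t)`, and existence follows since the truncated solutions converge locally
uniformly and `A` is closed (`IsTruncation.isWellPosed_iff`).

After conjugation with `Λ`, the operator `e^{tB_k} P_k` acts on Schwartz functions as the multiplier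
`Λ e^{ta} Λ⁻¹ χ_k` (`toLp_exp_opProd`). The uniform bound is therefore an `Lᵖ` bound for `op[Λ
e^{ta} Λ⁻¹]` on band-limited functions. Concentrating the Fourier transform of test functions at a
point shows that such a bound also controls the entries of the symbol, which gives the `L^∞`
condition (`norm_entry_le_of_eLpNorm_le`); dominated convergence and Fatou's lemma then extend the
bound to all Schwartz functions (`isMultiplierBound_of_isBandLimited`).

A shift of all orders by the same `r` multiplies `Λ` by the scalar `⟨ξ⟩^r`, which cancels in `Λ
e^{ta} Λ⁻¹`. The multiplier condition is thus the same for all shifted spaces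
(`conjugatedExp_add_const`). -/

noncomputable section

namespace MixedOrder

/-! ### Well-posedness by strong approximation with bounded operators. -/

section Abstract

open Filter Topology

variable {X : Type*} [NormedAddCommGroup X] [NormedSpace ℂ X]

theorem exp_smul_apply_comm (B : X →L[ℂ] X) (x : X) (t : ℝ) :
    NormedSpace.exp (t • B) (B x) = B (NormedSpace.exp (t • B) x) := by
  have h : Commute (NormedSpace.exp (t • B)) B := ((Commute.refl B).smul_left t).exp_left
  exact congrArg (fun L : X →L[ℂ] X => L x) h.eq

/-- Time is real while the operators are complex linear, so scalars are restricted before the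
product rule is applied. -/
theorem _root_.HasDerivAt.clm_apply_complex {c : ℝ → X →L[ℂ] X} {c' : X →L[ℂ] X} {u : ℝ → X}
    {u' : X} {t : ℝ} (hc : HasDerivAt c c' t) (hu : HasDerivAt u u' t) :
    HasDerivAt (fun τ => c τ (u τ)) (c' (u t) + c t u') t :=
  ((ContinuousLinearMap.restrictScalarsL ℂ X X ℝ ℝ).hasFDerivAt.comp_hasDerivAt t hc).clm_apply hu

/-- Approximation of an unbounded operator `A` by bounded operators `B k` which agree with `A` on
the ranges of operators `P k` converging strongly to the identity. -/
structure IsTruncation (A : X →ₗ.[ℂ] X) (P B : ℕ → X →L[ℂ] X) : Prop where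
  tendsto : ∀ x, Tendsto (fun k => P k x) atTop (𝓝 x)
  range_le : ∀ k x, ∃ h : P k x ∈ A.domain, A ⟨P k x, h⟩ = B k (P k x)
  apply_domain : ∀ k (x : A.domain), B k (P k x) = P k (A x)
  commute : ∀ k, Commute (P k) (B k)
  absorb : ∀ j k, j < k → ∀ x, P k (P j x) = P j x

namespace IsTruncation

variable {A : X →ₗ.[ℂ] X} {P B : ℕ → X →L[ℂ] X}

theorem exp_comm (h : IsTruncation A P B) (k : ℕ) (t : ℝ) (x : X) :
    NormedSpace.exp (t • B k) (P k x) = P k (NormedSpace.exp (t • B k) x) := by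
  have h : Commute (NormedSpace.exp (t • B k)) (P k) :=
    ((h.commute k).symm.smul_left t).exp_left
  exact congrArg (fun L : X →L[ℂ] X => L x) h.eq

end IsTruncation

variable [CompleteSpace X]

theorem hasDerivAt_exp_smul_apply (B : X →L[ℂ] X) (x : X) (t : ℝ) :
    HasDerivAt (fun t : ℝ => NormedSpace.exp (t • B) x) (NormedSpace.exp (t • B) (B x)) t :=
  ((hasDerivAt_exp_smul_const (𝕂 := ℝ) B t).clm_apply_complex (hasDerivAt_const t x)).congr_deriv
    (by simp)

theorem continuous_exp_smul (B : X →L[ℂ] X) : Continuous fun t : ℝ => NormedSpace.exp (t • B) :=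
  continuous_iff_continuousAt.2 fun t => (hasDerivAt_exp_smul_const (𝕂 := ℝ) B t).continuousAt

namespace IsTruncation

variable {A : X →ₗ.[ℂ] X} {P B : ℕ → X →L[ℂ] X}

/-- Strongly convergent sequences are pointwise bounded, hence uniformly bounded by
Banach–Steinhaus. -/
theorem exists_norm_le (h : IsTruncation A P B) : ∃ C, 0 < C ∧ ∀ k, ‖P k‖ ≤ C := by
  obtain ⟨C, hC⟩ := banach_steinhaus (g := P) fun x => by
    obtain ⟨C, hC⟩ := (h.tendsto x).norm.bddAbove_range
    exact ⟨C, fun k => hC ⟨k, rfl⟩⟩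
  exact ⟨max C 1, by positivity, fun k => (hC k).trans (le_max_left _ _)⟩

/-- The exponential commutes with `P k`, so the curve never leaves the range of `P k`, where `A`
coincides with `B k`. -/
theorem isClassicalSolution (h : IsTruncation A P B) (k : ℕ) (x : X) :
    IsClassicalSolution A (P k x) fun t => NormedSpace.exp (t • B k) (P k x) where
  contDiffOn := by
    refine ContDiff.contDiffOn (contDiff_one_iff_deriv.2 ⟨fun t =>
      (hasDerivAt_exp_smul_apply _ _ t).differentiableAt, ?_⟩)
    have : deriv (fun t : ℝ => NormedSpace.exp (t • B k) (P k x)) =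
        fun t => NormedSpace.exp (t • B k) (B k (P k x)) :=
      funext fun t => (hasDerivAt_exp_smul_apply _ _ t).deriv
    rw [this]
    exact continuous_iff_continuousAt.2 fun t => (hasDerivAt_exp_smul_apply _ _ t).continuousAt
  initial := by simp
  equation := fun t _ => by
    rw [h.exp_comm]
    obtain ⟨h1, h2⟩ := h.range_le k (NormedSpace.exp (t • B k) x)
    refine ⟨h1, ?_⟩
    rw [h2, ← h.exp_comm, ← exp_smul_apply_comm]
    exact hasDerivAt_exp_smul_apply _ _ t

theorem exp_bound_of_isWellPosed (h : IsTruncation A P B) (hA : IsWellPosed A) (T : ℝ)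
    (hT : 0 ≤ T) : ∃ C, 0 < C ∧ ∀ t ∈ Icc 0 T, ∀ k x,
      ‖NormedSpace.exp (t • B k) (P k x)‖ ≤ C * ‖x‖ := by
  -- The estimate needs a positive time horizon, whereas `T = 0` is allowed here.
  obtain ⟨C, hC, hC'⟩ := hA.estimate (T + 1) (by linarith)
  obtain ⟨D, hD, hD'⟩ := h.exists_norm_le
  refine ⟨C * D, by positivity, fun t ht k x => ?_⟩
  obtain ⟨h1, -⟩ := h.range_le k x
  calc _ ≤ C * ‖P k x‖ := hC' _ h1 _ (h.isClassicalSolution k x) t ⟨ht.1, by linarith [ht.2]⟩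
    _ ≤ C * (D * ‖x‖) := by gcongr; exact (P k).le_of_opNorm_le (hD' k) x
    _ = _ := by ring

/-- Truncating a classical solution gives the solution of the truncated problem. -/
theorem truncate_solution (h : IsTruncation A P B) {u₀ : X} {u : ℝ → X}
    (hu : IsClassicalSolution A u₀ u) (k : ℕ) {t : ℝ} (ht : 0 ≤ t) :
    P k (u t) = NormedSpace.exp (t • B k) (P k u₀) := by
  -- Variation of constants: `e^{-τB_k} P_k u(τ)` has derivative zero because `P_k A u = B_k P_k u`,
  -- and is therefore constant.
  have hcont : ContinuousOn (fun τ : ℝ => NormedSpace.exp ((-τ) • B k) (P k (u τ))) (Ici 0) := by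
    exact ContinuousOn.clm_apply ((continuous_exp_smul (B k)).comp continuous_neg).continuousOn
      ((P k).continuous.comp_continuousOn hu.contDiffOn.continuousOn)
  have hder : ∀ τ : ℝ, 0 < τ →
      HasDerivAt (fun τ : ℝ => NormedSpace.exp ((-τ) • B k) (P k (u τ))) 0 τ := by
    intro τ hτ
    obtain ⟨hd, hu'⟩ := hu.equation τ hτ
    have h1 := (hasDerivAt_exp_smul_const (𝕂 := ℝ) (B k) (-τ)).scomp τ (hasDerivAt_neg τ)
    have h2 : HasDerivAt (fun τ => P k (u τ)) (P k (A ⟨u τ, hd⟩)) τ :=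
      ((P k).restrictScalars ℝ).hasFDerivAt.comp_hasDerivAt τ hu'
    have h3 := h1.clm_apply_complex h2
    refine h3.congr_deriv ?_
    have h4 := h.apply_domain k ⟨u τ, hd⟩
    simp only [← h4]
    simp
  have hconst : NormedSpace.exp ((-t) • B k) (P k (u t)) = P k u₀ := by
    have := constant_of_has_deriv_right_zero (f := fun τ : ℝ =>
      NormedSpace.exp ((-τ) • B k) (P k (u τ))) (a := 0) (b := t) (hcont.mono Icc_subset_Ici_self)
      (fun τ hτ => ?_) t ⟨ht, le_rfl⟩
    · simpa [hu.initial] using this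
    -- The equation is only assumed for positive times; at `τ = 0` the right derivative is the limit
    -- of the derivatives from the right.
    · rcases hτ.1.eq_or_lt with rfl | hτ'
      · refine hasDerivWithinAt_Ici_of_tendsto_deriv (s := Ioi 0)
          (fun τ hτ => (hder τ hτ).differentiableAt.differentiableWithinAt)
          ((hcont 0 self_mem_Ici).mono Ioi_subset_Ici_self) self_mem_nhdsWithin ?_
        refine tendsto_const_nhds.congr' ?_
        filter_upwards [self_mem_nhdsWithin] with τ hτ using (hder τ hτ).deriv.symm
      · exact (hder τ hτ').hasDerivWithinAt
  let : NormedAlgebra ℚ (X →L[ℂ] X) := NormedAlgebra.restrictScalars ℚ ℝ _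
  rw [← hconst, ← mul_apply_eq_comp, ← NormedSpace.exp_add_of_commute, ← add_smul]
  · simp
  · exact ((Commute.refl _).smul_left _).smul_right _

/-- The curve `e^{tB_j} P_j x` is a classical solution fixed by `P_k`, so truncating it at the finer
level `k` changes nothing. -/
theorem exp_apply_eq (h : IsTruncation A P B) {j k : ℕ} (hjk : j < k) {t : ℝ} (ht : 0 ≤ t) (x : X) :
    NormedSpace.exp (t • B k) (P j x) = NormedSpace.exp (t • B j) (P j x) := by
  have h1 := h.truncate_solution (h.isClassicalSolution j x) k ht
  rw [h.absorb j k hjk] at h1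
  rw [← h1, h.exp_comm j, h.absorb j k hjk]

/-- For `k > j`, consistency of the truncations gives `e^{tB_k} P_k x - e^{tB_j} P_j x = e^{tB_k}
P_k (x - P_j x)`. This is at most `C ‖x - P_j x‖` on `[0, T]`, so the sequence is Cauchy uniformly
in `t`. -/
theorem exists_limit (h : IsTruncation A P B)
    (hb : ∀ T : ℝ, 0 ≤ T → ∃ C, 0 < C ∧ ∀ t ∈ Icc 0 T, ∀ k x,
      ‖NormedSpace.exp (t • B k) (P k x)‖ ≤ C * ‖x‖) (x : X) :
    ∃ w : ℝ → X, ContinuousOn w (Ici 0) ∧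
      ∀ t, 0 ≤ t → Tendsto (fun k => NormedSpace.exp (t • B k) (P k x)) atTop (𝓝 (w t)) := by
  have hcauchy : ∀ T : ℝ, 0 ≤ T → UniformCauchySeqOn
      (fun k (t : ℝ) => NormedSpace.exp (t • B k) (P k x)) atTop (Icc 0 T) := by
    intro T hT
    obtain ⟨C, hC, hb⟩ := hb T hT
    rw [Metric.uniformCauchySeqOn_iff]
    intro ε hε
    obtain ⟨j, hj⟩ := ((tendsto_iff_dist_tendsto_zero.1 (h.tendsto x)).eventually
      (gt_mem_nhds (show 0 < ε / (2 * C) by positivity))).exists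
    have key : ∀ k ≥ j + 1, ∀ t ∈ Icc 0 T, dist (NormedSpace.exp (t • B k) (P k x))
        (NormedSpace.exp (t • B j) (P j x)) < ε / 2 := by
      intro k hk t ht
      have := hb t ht k (x - P j x)
      rw [map_sub, map_sub, h.absorb j k hk, h.exp_apply_eq hk ht.1, ← dist_eq_norm, ← dist_eq_norm,
        dist_comm x] at this
      calc _ ≤ _ := this
        _ < C * (ε / (2 * C)) := by gcongr
        _ = ε / 2 := by field_simp
    refine ⟨j + 1, fun k hk l hl t ht => ?_⟩
    linarith [dist_triangle_right (NormedSpace.exp (t • B k) (P k x))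
      (NormedSpace.exp (t • B l) (P l x)) (NormedSpace.exp (t • B j) (P j x)),
      key k hk t ht, key l hl t ht]
  have hlim : ∀ t : ℝ, ∃ y, 0 ≤ t →
      Tendsto (fun k => NormedSpace.exp (t • B k) (P k x)) atTop (𝓝 y) := by
    intro t
    by_cases ht : 0 ≤ t
    · obtain ⟨y, hy⟩ := cauchySeq_tendsto_of_complete
        ((hcauchy t ht).cauchySeq (x := t) ⟨ht, le_rfl⟩)
      exact ⟨y, fun _ => hy⟩
    · exact ⟨0, fun h => absurd h ht⟩
  choose w hw using hlim
  refine ⟨w, fun t ht => ?_, hw⟩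
  have hunif := (hcauchy (t + 1) (by linarith [mem_Ici.1 ht])).tendstoUniformlyOn_of_tendsto
    fun τ hτ => hw τ hτ.1
  have hc : ContinuousOn w (Icc 0 (t + 1)) := hunif.continuousOn <| Frequently.of_forall fun k =>
    (((continuous_exp_smul (B k)).clm_apply continuous_const).continuousOn)
  refine (hc t ⟨ht, by linarith⟩).mono_of_mem_nhdsWithin ?_
  rw [← Ici_inter_Iic]
  exact inter_mem_nhdsWithin _ (Iic_mem_nhds (by linarith))

/-- Let `u` and `w` be the limits belonging to `u₀` and `A u₀`. The truncated equations in
integrated form yield `u(t) = u₀ + ∫₀ᵗ w`, hence `u' = w`, and closedness of `A` yields `A u = w`.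
-/
theorem existence (h : IsTruncation A P B) (hA : A.IsClosed)
    (hb : ∀ T : ℝ, 0 ≤ T → ∃ C, 0 < C ∧ ∀ t ∈ Icc 0 T, ∀ k x,
      ‖NormedSpace.exp (t • B k) (P k x)‖ ≤ C * ‖x‖) (u₀ : A.domain) :
    ∃ u : ℝ → X, IsClassicalSolution A u₀ u := by
  obtain ⟨u, -, hu⟩ := h.exists_limit hb u₀
  obtain ⟨w, hwc, hw⟩ := h.exists_limit hb (A u₀)
  -- Freezing `w` at its initial value for negative times makes it continuous on the whole line, so
  -- that the primitive is `C¹` there.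
  have hwc' : Continuous fun t => w (max t 0) :=
    hwc.comp_continuous (by fun_prop) fun t => le_max_right t 0
  have hint : ∀ t, 0 ≤ t → u t = u₀ + ∫ τ in (0 : ℝ)..t, w (max τ 0) := by
    intro t ht
    refine tendsto_nhds_unique (hu t ht) ?_
    have h1 : ∀ k, NormedSpace.exp (t • B k) (P k u₀) =
        P k u₀ + ∫ τ in (0 : ℝ)..t, NormedSpace.exp (τ • B k) (P k (A u₀)) := by
      intro k
      rw [intervalIntegral.integral_eq_sub_of_hasDerivAt (fun τ _ => ?_)
        (((continuous_exp_smul (B k)).clm_apply continuous_const).intervalIntegrable _ _)]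
      rotate_left
      · exact fun τ => NormedSpace.exp (τ • B k) (P k u₀)
      · simpa [h.apply_domain] using hasDerivAt_exp_smul_apply (B k) (P k u₀) τ
      · simp
    simp only [h1]
    refine (h.tendsto u₀).add ?_
    obtain ⟨C, hC, hb⟩ := hb t ht
    refine intervalIntegral.tendsto_integral_filter_of_dominated_convergence
      (fun _ => C * ‖A u₀‖) (Eventually.of_forall fun k =>
        ((continuous_exp_smul (B k)).clm_apply continuous_const).aestronglyMeasurable)
      (Eventually.of_forall fun k => ?_) (by simp) ?_
    · refine Eventually.of_forall fun τ hτ => ?_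
      rw [uIoc_of_le ht] at hτ
      exact hb τ ⟨hτ.1.le, hτ.2⟩ k _
    · refine Eventually.of_forall fun τ hτ => ?_
      rw [uIoc_of_le ht] at hτ
      rw [max_eq_left hτ.1.le]
      exact hw τ hτ.1.le
  have hder : ∀ t, HasDerivAt (fun t => (u₀ : X) + ∫ τ in (0 : ℝ)..t, w (max τ 0)) (w (max t 0)) t :=
    fun t => (hwc'.integral_hasStrictDerivAt 0 t).hasDerivAt.const_add _
  refine ⟨fun t => u₀ + ∫ τ in (0 : ℝ)..t, w (max τ 0), ?_, by simp, fun t ht => ?_⟩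
  · refine ContDiff.contDiffOn (contDiff_one_iff_deriv.2 ⟨fun t => (hder t).differentiableAt, ?_⟩)
    rwa [funext fun t => (hder t).deriv]
  -- The pairs `(e^{tB_k} P_k u₀, e^{tB_k} P_k A u₀)` lie in the graph of `A` and converge to `(u t,
  -- w t)`.
  · have hgraph : (u t, w t) ∈ A.graph := by
      refine hA.mem_of_tendsto ((hu t ht.le).prodMk_nhds (hw t ht.le))
        (Eventually.of_forall fun k => ?_)
      obtain ⟨h1, h2⟩ := h.range_le k (NormedSpace.exp (t • B k) u₀)
      refine (LinearPMap.mem_graph_iff A).2 ⟨⟨_, h1⟩, (h.exp_comm k t u₀).symm, ?_⟩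
      rw [h2, ← h.apply_domain, exp_smul_apply_comm, h.exp_comm]
    obtain ⟨y, hy1, hy2⟩ := (LinearPMap.mem_graph_iff A).1 hgraph
    have hut : (y : X) = u₀ + ∫ τ in (0 : ℝ)..t, w (max τ 0) := hy1.trans (hint t ht.le)
    refine ⟨hut ▸ y.2, ?_⟩
    have : A ⟨_, hut ▸ y.2⟩ = w t := by
      refine Eq.trans ?_ hy2
      congr 1
      exact Subtype.ext hut.symm
    rw [this]
    simpa [ht.le] using hder t

/-- For the converse direction, `P_k u(t) = e^{tB_k} P_k u₀` depends only on `u₀`; the limit `k → ∞`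
gives uniqueness as well as the estimate. -/
theorem isWellPosed_iff (h : IsTruncation A P B) (hA : A.IsClosed)
    (hd : Dense (A.domain : Set X)) :
    IsWellPosed A ↔ ∀ T : ℝ, 0 ≤ T → ∃ C, 0 < C ∧ ∀ t ∈ Icc 0 T, ∀ k x,
      ‖NormedSpace.exp (t • B k) (P k x)‖ ≤ C * ‖x‖ := by
  refine ⟨h.exp_bound_of_isWellPosed, fun hb => ⟨hA, hd, fun u₀ hu₀ => h.existence hA hb ⟨u₀, hu₀⟩,
    fun u₀ _ u v hu hv t ht => ?_, fun T hT => ?_⟩⟩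
  · refine tendsto_nhds_unique (h.tendsto (u t)) ((h.tendsto (v t)).congr fun k => ?_)
    rw [h.truncate_solution hu k ht, h.truncate_solution hv k ht]
  · obtain ⟨C, hC, hb⟩ := hb T hT.le
    refine ⟨C, hC, fun u₀ _ u hu t ht => le_of_tendsto (h.tendsto (u t)).norm
      (Eventually.of_forall fun k => ?_)⟩
    rw [h.truncate_solution hu k ht.1]
    exact hb t ht k u₀

theorem isWellPosed_iff_exp_bound (h : IsTruncation A P B) (hA : A.IsClosed)
    (hd : Dense (A.domain : Set X)) :
    IsWellPosed A ↔ ∀ T : ℝ, 0 ≤ T → ∃ C, 0 < C ∧ ∀ t ∈ Icc 0 T, ∀ k x,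
      ‖NormedSpace.exp ((t : ℂ) • B k) (P k x)‖ ≤ C * ‖x‖ := by
  simpa only [Complex.coe_smul] using h.isWellPosed_iff hA hd

end IsTruncation

end Abstract

/-! ### Scalar multipliers in `C_c^∞` on `Lᵖ`, and dyadic frequency cutoffs. -/

section ScalarMultipliers

open Filter Topology
open scoped Convolution

variable {n : ℕ}

/-! ### Young's inequality for convolutions with an integrable kernel -/

/-- Hölder's inequality between `L¹` and `Lʳ` for the measure with density `|k|`. -/
theorem lintegral_mul_rpow_le {α : Type*} [MeasurableSpace α] {ν : Measure α} {k f : α → ℂ}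
    (hk : Measurable k) (hf : Measurable f) {r : ℝ} (hr : 1 ≤ r) :
    (∫⁻ t, ‖k t‖ₑ * ‖f t‖ₑ ∂ν) ^ r ≤
      (∫⁻ t, ‖k t‖ₑ ∂ν) ^ (r - 1) * ∫⁻ t, ‖k t‖ₑ * ‖f t‖ₑ ^ r ∂ν := by
  have hr0 : 0 < r := by linarith
  have h := eLpNorm'_le_eLpNorm'_mul_rpow_measure_univ (μ := ν.withDensity fun t => ‖k t‖ₑ)
    one_pos hr hf.aestronglyMeasurable
  simp only [eLpNorm', ENNReal.rpow_one, one_div_one] at h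
  rw [lintegral_withDensity_eq_lintegral_mul _ hk.enorm hf.enorm,
    lintegral_withDensity_eq_lintegral_mul _ hk.enorm (hf.enorm.pow_const r),
    withDensity_apply _ MeasurableSet.univ, setLIntegral_univ] at h
  have h' := ENNReal.rpow_le_rpow h hr0.le
  rw [ENNReal.mul_rpow_of_nonneg _ _ hr0.le, ← ENNReal.rpow_mul, ← ENNReal.rpow_mul,
    one_div_mul_cancel hr0.ne', ENNReal.rpow_one, sub_mul, one_mul,
    one_div_mul_cancel hr0.ne'] at h'
  exact h'.trans_eq (mul_comm _ _)

/-- The preceding inequality is integrated in `x`; Tonelli and translation invariance do the rest.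
-/
theorem eLpNorm_convolution_le {k f : Rn n → ℂ} (hk : Continuous k) (hki : Integrable k)
    (hf : Continuous f) {p : ℝ≥0∞} (hp : 1 ≤ p) (hp' : p ≠ ⊤) :
    eLpNorm (k ⋆[ContinuousLinearMap.mul ℂ ℂ] f) p ≤ (∫⁻ x, ‖k x‖ₑ) * eLpNorm f p := by
  have hp0 : p ≠ 0 := (zero_lt_one.trans_le hp).ne'
  have hr : 1 ≤ p.toReal := by simpa using ENNReal.toReal_mono hp' hp
  have hr0 : 0 < p.toReal := by linarith
  have hfin : ∫⁻ x, ‖k x‖ₑ ≠ ⊤ := hki.2.ne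
  rw [eLpNorm_eq_lintegral_rpow_enorm_toReal hp0 hp', eLpNorm_eq_lintegral_rpow_enorm_toReal hp0 hp']
  set r := p.toReal
  rw [one_div, ENNReal.rpow_inv_le_iff hr0, ENNReal.mul_rpow_of_nonneg _ _ hr0.le, ← ENNReal.rpow_mul,
    inv_mul_cancel₀ hr0.ne', ENNReal.rpow_one]
  calc ∫⁻ x, ‖(k ⋆[ContinuousLinearMap.mul ℂ ℂ] f) x‖ₑ ^ r
      ≤ ∫⁻ x, (∫⁻ t, ‖k t‖ₑ) ^ (r - 1) * ∫⁻ t, ‖k t‖ₑ * ‖f (x - t)‖ₑ ^ r := by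
        refine lintegral_mono fun x => ?_
        refine le_trans (ENNReal.rpow_le_rpow ?_ hr0.le) (lintegral_mul_rpow_le hk.measurable
          (hf.comp (continuous_const.sub continuous_id)).measurable hr)
        refine (enorm_integral_le_lintegral_enorm _).trans (lintegral_mono fun t => ?_)
        simp
    _ = (∫⁻ t, ‖k t‖ₑ) ^ (r - 1) * ∫⁻ x, ∫⁻ t, ‖k t‖ₑ * ‖f (x - t)‖ₑ ^ r :=
        lintegral_const_mul' _ _ (ENNReal.rpow_ne_top_of_nonneg (by linarith) hfin)
    _ = (∫⁻ t, ‖k t‖ₑ) ^ (r - 1) * ∫⁻ t, ∫⁻ x, ‖k t‖ₑ * ‖f (x - t)‖ₑ ^ r := by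
        rw [lintegral_lintegral_swap]
        refine Measurable.aemeasurable ?_
        exact (hk.comp continuous_snd).measurable.enorm.mul
          ((hf.comp (continuous_fst.sub continuous_snd)).measurable.enorm.pow_const r)
    _ = (∫⁻ t, ‖k t‖ₑ) ^ (r - 1) * ∫⁻ t, ‖k t‖ₑ * ∫⁻ x, ‖f x‖ₑ ^ r := by
        congr 1
        refine lintegral_congr fun t => ?_
        rw [lintegral_const_mul' _ _ enorm_ne_top,
          lintegral_sub_right_eq_self (fun x => ‖f x‖ₑ ^ r) t]
    _ = (∫⁻ t, ‖k t‖ₑ) ^ r * ∫⁻ x, ‖f x‖ₑ ^ r := by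
        rw [lintegral_mul_const _ hk.measurable.enorm, ← mul_assoc]
        congr 1
        nth_rw 2 [← ENNReal.rpow_one (∫⁻ t, ‖k t‖ₑ)]
        rw [← ENNReal.rpow_add_of_nonneg _ _ (by linarith) zero_le_one, sub_add_cancel]

/-! ### Multipliers in `C_c^∞` -/

/-- `g ∈ C_c^∞(ℝⁿ)`. -/
structure IsTestFun (g : Rn n → ℂ) : Prop where
  contDiff : ContDiff ℝ ∞ g
  compact : HasCompactSupport g

namespace IsTestFun

variable {g h : Rn n → ℂ}

theorem hasTemperateGrowth (hg : IsTestFun g) : g.HasTemperateGrowth :=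
  hg.compact.hasTemperateGrowth hg.contDiff

theorem mul_contDiff (hg : IsTestFun g) (hh : ContDiff ℝ ∞ h) : IsTestFun fun ξ => g ξ * h ξ :=
  ⟨hg.contDiff.mul hh, hg.compact.mul_right⟩

theorem comp_smul (hg : IsTestFun g) {c : ℝ} (hc : c ≠ 0) : IsTestFun fun ξ => g (c • ξ) :=
  ⟨hg.contDiff.comp (contDiff_const_smul c), hg.compact.comp_smul hc⟩

theorem rescale (hg : IsTestFun g) : IsTestFun (rescale g) :=
  hg.comp_smul (neg_ne_zero.2 Real.two_pi_pos.ne')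

/-- `g` as a Schwartz function. -/
def toSchwartz (hg : IsTestFun g) : 𝓢(Rn n, ℂ) := hg.compact.toSchwartzMap hg.contDiff

theorem toSchwartz_apply (hg : IsTestFun g) (ξ : Rn n) : hg.toSchwartz ξ = g ξ := rfl

theorem coe_toSchwartz (hg : IsTestFun g) : ⇑hg.toSchwartz = g := rfl

theorem fourierMultiplierCLM_eq_convolution (hg : IsTestFun g) (φ : 𝓢(Rn n, ℂ)) :
    SchwartzMap.fourierMultiplierCLM ℂ g φ =
      SchwartzMap.convolution (ContinuousLinearMap.mul ℂ ℂ) (𝓕⁻ hg.toSchwartz) φ := by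
  change 𝓕⁻ (SchwartzMap.smulLeftCLM ℂ g (𝓕 φ)) =
    𝓕⁻ (SchwartzMap.pairing (ContinuousLinearMap.mul ℂ ℂ) (𝓕 (𝓕⁻ hg.toSchwartz)) (𝓕 φ))
  rw [FourierTransform.fourier_fourierInv_eq]
  congr 1
  ext ξ
  simp [SchwartzMap.smulLeftCLM_apply_apply hg.hasTemperateGrowth, toSchwartz_apply]

theorem eLpNorm_fourierMultiplierCLM_le (hg : IsTestFun g) {p : ℝ≥0∞} (hp : 1 ≤ p) (hp' : p ≠ ⊤)
    (φ : 𝓢(Rn n, ℂ)) :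
    eLpNorm (SchwartzMap.fourierMultiplierCLM ℂ g φ) p ≤
      (∫⁻ x, ‖(𝓕⁻ hg.toSchwartz) x‖ₑ) * eLpNorm φ p := by
  have h : ⇑(SchwartzMap.fourierMultiplierCLM ℂ g φ) =
      ⇑(𝓕⁻ hg.toSchwartz : 𝓢(Rn n, ℂ)) ⋆[ContinuousLinearMap.mul ℂ ℂ] φ := by
    funext x
    rw [hg.fourierMultiplierCLM_eq_convolution, SchwartzMap.convolution_apply]
  rw [h]
  exact eLpNorm_convolution_le (𝓕⁻ hg.toSchwartz).continuous (𝓕⁻ hg.toSchwartz).integrable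
    φ.continuous hp hp'

/-- Dilating a symbol dilates its kernel without changing the `L¹` norm. This is what bounds all
dyadic cutoffs by one constant. -/
theorem lintegral_fourierInv_comp_smul (hg : IsTestFun g) {c : ℝ} (hc : 0 < c) :
    ∫⁻ x, ‖(𝓕⁻ (hg.comp_smul hc.ne').toSchwartz) x‖ₑ = ∫⁻ x, ‖(𝓕⁻ hg.toSchwartz) x‖ₑ := by
  have h1 : ∀ x, (𝓕⁻ (hg.comp_smul hc.ne').toSchwartz) x =
      ((c ^ n)⁻¹ : ℝ) • (𝓕⁻ hg.toSchwartz) (c⁻¹ • x) := by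
    intro x
    rw [SchwartzMap.fourierInv_coe, SchwartzMap.fourierInv_coe, Real.fourierInv_eq,
      Real.fourierInv_eq]
    have := Measure.integral_comp_smul (volume : Measure (Rn n))
      (fun v => Real.fourierChar (inner ℝ v (c⁻¹ • x)) • g v) c
    rw [finrank_euclideanSpace_fin, abs_of_pos (by positivity)] at this
    rw [coe_toSchwartz, coe_toSchwartz, ← this]
    congr 1
    funext v
    rw [inner_smul_left, inner_smul_right]
    simp [hc.ne']
  have h2 := lintegral_map (μ := (volume : Measure (Rn n)))
    (f := fun x => ‖(𝓕⁻ hg.toSchwartz) x‖ₑ) (𝓕⁻ hg.toSchwartz).continuous.measurable.enorm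
    (measurable_const_smul c⁻¹)
  rw [Measure.map_addHaar_smul _ (inv_ne_zero hc.ne'), lintegral_smul_measure,
    finrank_euclideanSpace_fin] at h2
  simp only [h1, enorm_smul]
  rw [lintegral_const_mul' _ _ enorm_ne_top, ← h2, smul_eq_mul, ← mul_assoc]
  rw [Real.enorm_eq_ofReal (by positivity), ← ENNReal.ofReal_mul (by positivity),
    abs_of_pos (by positivity)]
  simp [hc.ne']

variable {F : Type*} [NormedAddCommGroup F] [NormedSpace ℂ F]

/-- The derivatives of `g - 1` vanish at the origin and are bounded, if `g ∈ C_c^∞` is `1` near the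
origin. -/
theorem exists_iteratedFDeriv_sub_one_le (hg : IsTestFun g) (h1 : g =ᶠ[𝓝 0] fun _ => 1) (i : ℕ) :
    ∃ C, 0 ≤ C ∧ ∀ ξ, ‖iteratedFDeriv ℝ i (fun ξ => g ξ - 1) ξ‖ ≤ C * ‖ξ‖ := by
  have hzero : ∀ᶠ ξ in 𝓝 (0 : Rn n), iteratedFDeriv ℝ i (fun ξ => g ξ - 1) ξ = 0 := by
    have h : (fun ξ => g ξ - 1) =ᶠ[𝓝 0] fun _ => (0 : ℂ) := by
      filter_upwards [h1] with ξ hξ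
      simp [hξ]
    filter_upwards [h.iteratedFDeriv ℝ i] with ξ hξ
    rw [hξ]
    simp
  obtain ⟨δ, hδ, hball⟩ := Metric.eventually_nhds_iff_ball.1 hzero
  obtain ⟨C₁, hC₁⟩ := (hg.compact.iteratedFDeriv (𝕜 := ℝ) i).exists_bound_of_continuous
    (hg.contDiff.continuous_iteratedFDeriv (by exact_mod_cast le_top))
  have hconst : ∃ C₂, ∀ ξ : Rn n, ‖iteratedFDeriv ℝ i (fun _ : Rn n => (1 : ℂ)) ξ‖ ≤ C₂ := by
    rcases eq_or_ne i 0 with rfl | hi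
    · exact ⟨1, fun ξ => by simp⟩
    · exact ⟨0, fun ξ => by simp [iteratedFDeriv_const_of_ne hi]⟩
  obtain ⟨C₂, hC₂⟩ := hconst
  have hC1 : 0 ≤ C₁ := (norm_nonneg _).trans (hC₁ 0)
  have hC2 : 0 ≤ C₂ := (norm_nonneg _).trans (hC₂ 0)
  refine ⟨(C₁ + C₂) / δ, by positivity, fun ξ => ?_⟩
  by_cases hξ : ξ ∈ Metric.ball 0 δ
  · rw [hball ξ hξ, norm_zero]
    positivity
  · have hξ' : δ ≤ ‖ξ‖ := by simpa using hξ
    have hb : ‖iteratedFDeriv ℝ i (fun ξ => g ξ - 1) ξ‖ ≤ C₁ + C₂ := by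
      have := iteratedFDeriv_sub_apply (𝕜 := ℝ) (x := ξ) (i := i) (f := g) (g := fun _ => (1 : ℂ))
        (hg.contDiff.contDiffAt.of_le (by exact_mod_cast le_top)) contDiffAt_const
      change ‖iteratedFDeriv ℝ i (g - fun _ => 1) ξ‖ ≤ _
      rw [this]
      exact (norm_sub_le _ _).trans (add_le_add (hC₁ ξ) (hC₂ ξ))
    refine hb.trans ?_
    rw [div_mul_eq_mul_div, le_div_iff₀ hδ]
    gcongr

/-- The derivatives of `g(c_k ·) - 1` are at most a constant times `c_k |ξ|`. By the Leibniz rule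
each seminorm of the difference is then `O(c_k)`, at the price of one more power of `|ξ|` on `ψ`. -/
theorem tendsto_smulLeftCLM_comp_smul (hg : IsTestFun g) (h1 : g =ᶠ[𝓝 0] fun _ => 1) {c : ℕ → ℝ}
    (hc0 : ∀ k, 0 < c k) (hc1 : ∀ k, c k ≤ 1) (hc : Tendsto c atTop (𝓝 0)) (ψ : 𝓢(Rn n, F)) :
    Tendsto (fun k => SchwartzMap.smulLeftCLM F (fun ξ => g (c k • ξ)) ψ) atTop (𝓝 ψ) := by
  rw [(schwartz_withSeminorms ℂ (Rn n) F).tendsto_nhds]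
  rintro ⟨m, l⟩ ε hε
  choose C hC0 hC using hg.exists_iteratedFDeriv_sub_one_le h1
  have hsmooth : ContDiff ℝ ∞ fun ξ => g ξ - 1 := hg.contDiff.sub contDiff_const
  set D := ∑ i ∈ Finset.range (l + 1),
    (l.choose i : ℝ) * C i * SchwartzMap.seminorm ℂ (m + 1) (l - i) ψ with hD
  have hD0 : 0 ≤ D := Finset.sum_nonneg fun i _ =>
    mul_nonneg (mul_nonneg (Nat.cast_nonneg _) (hC0 i)) (apply_nonneg _ _)
  have hle : ∀ k, SchwartzMap.seminorm ℂ m l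
      (SchwartzMap.smulLeftCLM F (fun ξ => g (c k • ξ)) ψ - ψ) ≤ c k * D := by
    intro k
    refine SchwartzMap.seminorm_le_bound ℂ m l _ (mul_nonneg (hc0 k).le hD0) fun ξ => ?_
    have hfun : ⇑(SchwartzMap.smulLeftCLM F (fun ξ => g (c k • ξ)) ψ - ψ) =
        fun ξ => (g (c k • ξ) - 1) • ψ ξ := by
      funext ξ
      simp [SchwartzMap.smulLeftCLM_apply_apply (hg.comp_smul (hc0 k).ne').hasTemperateGrowth,
        sub_smul]
    have hder : ∀ i, ‖iteratedFDeriv ℝ i (fun ξ => g (c k • ξ) - 1) ξ‖ ≤ c k * (C i * ‖ξ‖) := by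
      intro i
      have h2 := iteratedFDeriv_comp_const_smul (𝕜 := ℝ) (f := fun ξ => g ξ - 1) (i := i) (c k)
        (hsmooth.of_le (by exact_mod_cast le_top))
      rw [h2, norm_smul, norm_pow, Real.norm_of_nonneg (hc0 k).le]
      calc _ ≤ 1 * (C i * ‖c k • ξ‖) := by
            gcongr
            · exact pow_le_one₀ (hc0 k).le (hc1 k)
            · exact hC i _
        _ = _ := by rw [norm_smul, Real.norm_of_nonneg (hc0 k).le]; ring
    rw [hfun]
    calc ‖ξ‖ ^ m * ‖iteratedFDeriv ℝ l (fun ξ => (g (c k • ξ) - 1) • ψ ξ) ξ‖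
        ≤ ‖ξ‖ ^ m * ∑ i ∈ Finset.range (l + 1), (l.choose i : ℝ) *
          ‖iteratedFDeriv ℝ i (fun ξ => g (c k • ξ) - 1) ξ‖ * ‖iteratedFDeriv ℝ (l - i) ψ ξ‖ := by
          gcongr
          exact norm_iteratedFDeriv_smul_le (N := ∞)
            (hsmooth.comp (contDiff_const_smul (c k))) (ψ.smooth ⊤) ξ (by exact_mod_cast le_top)
      _ ≤ ‖ξ‖ ^ m * ∑ i ∈ Finset.range (l + 1), (l.choose i : ℝ) *
          (c k * (C i * ‖ξ‖)) * ‖iteratedFDeriv ℝ (l - i) ψ ξ‖ := by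
          gcongr with i
          exact hder i
      _ = c k * ∑ i ∈ Finset.range (l + 1), (l.choose i : ℝ) * C i *
          (‖ξ‖ ^ (m + 1) * ‖iteratedFDeriv ℝ (l - i) ψ ξ‖) := by
          rw [Finset.mul_sum, Finset.mul_sum]
          exact Finset.sum_congr rfl fun i _ => by ring
      _ ≤ c k * D := by
          refine mul_le_mul_of_nonneg_left (Finset.sum_le_sum fun i _ => ?_) (hc0 k).le
          exact mul_le_mul_of_nonneg_left (SchwartzMap.le_seminorm ℂ _ _ ψ ξ)
            (mul_nonneg (Nat.cast_nonneg _) (hC0 i))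
  have hlim : Tendsto (fun k => c k * D) atTop (𝓝 0) := by simpa using hc.mul_const D
  filter_upwards [hlim.eventually (gt_mem_nhds hε)] with k hk using (hle k).trans_lt hk

end IsTestFun

/-! ### Dyadic cutoffs -/

/-- A smooth function with values in `[0, 1]` that is `1` on the unit ball and vanishes outside the
ball of radius `2`. -/
def bump (n : ℕ) : ContDiffBump (0 : Rn n) := ⟨1, 2, one_pos, one_lt_two⟩

/-- A function in `C_c^∞(ℝⁿ)` that is `1` for `|ξ| ≤ 2^k` and vanishes for `|ξ| ≥ 2^{k+1}`. -/
def cutoff (n k : ℕ) (ξ : Rn n) : ℂ := (bump n (((2 : ℝ) ^ k)⁻¹ • ξ) : ℝ)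

theorem isTestFun_bump (n : ℕ) : IsTestFun fun ξ : Rn n => ((bump n ξ : ℝ) : ℂ) :=
  ⟨Complex.ofRealCLM.contDiff.comp (bump n).contDiff,
    (bump n).hasCompactSupport.comp_left (g := Complex.ofReal) rfl⟩

theorem isTestFun_cutoff (n k : ℕ) : IsTestFun (cutoff n k) :=
  (isTestFun_bump n).comp_smul (by positivity)

theorem cutoff_eq_one {k : ℕ} {ξ : Rn n} (h : ‖ξ‖ ≤ 2 ^ k) : cutoff n k ξ = 1 := by
  have : bump n (((2 : ℝ) ^ k)⁻¹ • ξ) = 1 := by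
    refine (bump n).one_of_mem_closedBall ?_
    rw [mem_closedBall_zero_iff, norm_smul, norm_inv, norm_pow, Real.norm_ofNat,
      inv_mul_le_iff₀ (by positivity)]
    simpa [bump] using h
  rw [cutoff, this, Complex.ofReal_one]

theorem cutoff_eq_zero {k : ℕ} {ξ : Rn n} (h : 2 ^ (k + 1) ≤ ‖ξ‖) : cutoff n k ξ = 0 := by
  have : bump n (((2 : ℝ) ^ k)⁻¹ • ξ) = 0 := by
    refine (bump n).zero_of_le_dist ?_
    rw [dist_zero_right, norm_smul, norm_inv, norm_pow, Real.norm_ofNat,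
      le_inv_mul_iff₀ (by positivity)]
    simpa [bump, pow_succ] using h
  rw [cutoff, this, Complex.ofReal_zero]

theorem norm_cutoff_le (k : ℕ) (ξ : Rn n) : ‖cutoff n k ξ‖ ≤ 1 := by
  rw [cutoff, Complex.norm_real, Real.norm_of_nonneg (bump n).nonneg]
  exact (bump n).le_one

theorem cutoff_mul_cutoff {j k : ℕ} (h : j < k) (ξ : Rn n) :
    cutoff n k ξ * cutoff n j ξ = cutoff n j ξ := by
  rcases le_total ‖ξ‖ (2 ^ k) with h1 | h1
  · rw [cutoff_eq_one h1, one_mul]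
  · rw [cutoff_eq_zero (k := j) ((pow_le_pow_right₀ one_le_two h).trans h1), mul_zero]

theorem rescale_cutoff (k : ℕ) : rescale (cutoff n k) =
    fun η => rescale (fun ξ : Rn n => ((bump n ξ : ℝ) : ℂ)) (((2 : ℝ) ^ k)⁻¹ • η) := by
  funext η
  simp only [rescale, cutoff]
  rw [smul_comm]

theorem tendsto_smulLeftCLM_rescale_cutoff {F : Type*} [NormedAddCommGroup F] [NormedSpace ℂ F]
    (ψ : 𝓢(Rn n, F)) :
    Tendsto (fun k => SchwartzMap.smulLeftCLM F (rescale (cutoff n k)) ψ) atTop (𝓝 ψ) := by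
  simp only [rescale_cutoff]
  refine (isTestFun_bump n).rescale.tendsto_smulLeftCLM_comp_smul ?_ (fun k => by positivity)
    (fun k => inv_le_one_of_one_le₀ (one_le_pow₀ one_le_two)) ?_ ψ
  · have h1 : ∀ᶠ ξ in 𝓝 (0 : Rn n), ((bump n ξ : ℝ) : ℂ) = 1 := by
      filter_upwards [(bump n).eventuallyEq_one] with ξ hξ
      simp [hξ]
    have h2 : Tendsto (fun η : Rn n => (-(2 * Real.pi)) • η) (𝓝 0) (𝓝 0) := by
      have : Continuous fun η : Rn n => (-(2 * Real.pi)) • η := by fun_prop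
      simpa using this.tendsto 0
    exact h2.eventually h1
  · exact tendsto_inv_atTop_zero.comp (tendsto_pow_atTop_atTop_of_one_lt one_lt_two)

theorem tendsto_fourierMultiplierCLM_cutoff {F : Type*} [NormedAddCommGroup F] [NormedSpace ℂ F]
    [CompleteSpace F] (φ : 𝓢(Rn n, F)) :
    Tendsto (fun k => SchwartzMap.fourierMultiplierCLM F (rescale (cutoff n k)) φ) atTop
      (𝓝 φ) := by
  have h := ((FourierTransform.fourierInvCLM ℂ 𝓢(Rn n, F)).continuous.tendsto _).comp
    (tendsto_smulLeftCLM_rescale_cutoff (𝓕 φ))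
  simpa [SchwartzMap.fourierMultiplierCLM_apply, Function.comp_def] using h

/-! ### Extension to `Lᵖ` -/

section Extension

variable {p : ℝ≥0∞} [Fact (1 ≤ p)]

/-- The map `φ ↦ op[m] φ` from the Schwartz space to `Lᵖ(ℝⁿ)`. -/
def opSchwartzToLp (p : ℝ≥0∞) [Fact (1 ≤ p)] (m : Rn n → ℂ) :
    𝓢(Rn n, ℂ) →ₗ[ℂ] Lp ℂ p (volume : Measure (Rn n)) :=
  (SchwartzMap.toLpCLM ℂ ℂ p (volume : Measure (Rn n))).toLinearMap ∘ₗ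
    (SchwartzMap.fourierMultiplierCLM ℂ (rescale m)).toLinearMap

/-- The inclusion of the Schwartz space in `Lᵖ(ℝⁿ)`. -/
def schwartzToLp (n : ℕ) (p : ℝ≥0∞) [Fact (1 ≤ p)] :
    𝓢(Rn n, ℂ) →ₗ[ℂ] Lp ℂ p (volume : Measure (Rn n)) :=
  (SchwartzMap.toLpCLM ℂ ℂ p (volume : Measure (Rn n))).toLinearMap

theorem opSchwartzToLp_apply (m : Rn n → ℂ) (φ : 𝓢(Rn n, ℂ)) :
    opSchwartzToLp p m φ = (SchwartzMap.fourierMultiplierCLM ℂ (rescale m) φ).toLp p := rfl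

theorem schwartzToLp_apply (φ : 𝓢(Rn n, ℂ)) : schwartzToLp n p φ = φ.toLp p := rfl

/-- The extension of `op[m]` from the Schwartz space to `Lᵖ(ℝⁿ)`. -/
def opLp (p : ℝ≥0∞) [Fact (1 ≤ p)] (m : Rn n → ℂ) :
    Lp ℂ p (volume : Measure (Rn n)) →L[ℂ] Lp ℂ p (volume : Measure (Rn n)) :=
  (opSchwartzToLp p m).extendOfNorm (schwartzToLp n p)

theorem denseRange_toLp (hp : p ≠ ⊤) :
    DenseRange (schwartzToLp n p) :=
  SchwartzMap.denseRange_toLpCLM hp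

theorem lpEmb_continuous : Continuous (lpEmb n p) :=
  (Lp.toTemperedDistributionCLM ℂ (volume : Measure (Rn n)) p).continuous

theorem lpEmb_schwartz (φ : 𝓢(Rn n, ℂ)) : lpEmb n p (φ.toLp p) = (φ : 𝓢'(Rn n, ℂ)) :=
  Lp.toTemperedDistribution_toLp_eq φ

theorem IsTestFun.norm_toLp_fourierMultiplierCLM_le {g : Rn n → ℂ} (hg : IsTestFun g) (hp : p ≠ ⊤)
    (φ : 𝓢(Rn n, ℂ)) :
    ‖(SchwartzMap.fourierMultiplierCLM ℂ g φ).toLp p (volume : Measure (Rn n))‖ ≤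
      (∫⁻ x, ‖(𝓕⁻ hg.toSchwartz) x‖ₑ).toReal * ‖φ.toLp p (volume : Measure (Rn n))‖ := by
  have hfin : ∫⁻ x, ‖(𝓕⁻ hg.toSchwartz) x‖ₑ ≠ ⊤ :=
    (SchwartzMap.integrable (μ := volume) (𝓕⁻ hg.toSchwartz)).2.ne
  rw [SchwartzMap.norm_toLp, SchwartzMap.norm_toLp, ← ENNReal.toReal_mul]
  exact ENNReal.toReal_mono (ENNReal.mul_ne_top hfin (φ.eLpNorm_lt_top p volume).ne)
    (hg.eLpNorm_fourierMultiplierCLM_le Fact.out hp φ)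

/-- Young's inequality supplies the bound under which the extension by density really restricts to
the given operator. -/
theorem opLp_toLp (hp : p ≠ ⊤) {m : Rn n → ℂ} (hm : IsTestFun m) (φ : 𝓢(Rn n, ℂ)) :
    opLp p m (φ.toLp p) = (SchwartzMap.fourierMultiplierCLM ℂ (rescale m) φ).toLp p := by
  have hnorm : ∃ C, ∀ φ, ‖opSchwartzToLp p m φ‖ ≤ C * ‖schwartzToLp n p φ‖ := by
    refine ⟨(∫⁻ x, ‖(𝓕⁻ hm.rescale.toSchwartz) x‖ₑ).toReal, fun φ => ?_⟩
    rw [opSchwartzToLp_apply, schwartzToLp_apply]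
    exact hm.rescale.norm_toLp_fourierMultiplierCLM_le hp φ
  rw [← schwartzToLp_apply, opLp, LinearMap.extendOfNorm_eq (e := schwartzToLp n p) (denseRange_toLp hp) hnorm,
    opSchwartzToLp_apply]

theorem lpEmb_opLp (hp : p ≠ ⊤) {m : Rn n → ℂ} (hm : IsTestFun m)
    (f : Lp ℂ p (volume : Measure (Rn n))) : lpEmb n p (opLp p m f) = op m (lpEmb n p f) := by
  induction f using (denseRange_toLp (n := n) (p := p) hp).induction_on with
  | hp =>
    exact isClosed_eq (lpEmb_continuous.comp (opLp p m).continuous)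
      ((op m).continuous.comp lpEmb_continuous)
  | ih φ =>
    rw [schwartzToLp_apply, opLp_toLp hp hm, lpEmb_schwartz, lpEmb_schwartz, op_schwartz hm.hasTemperateGrowth]

theorem exists_norm_opLp_cutoff_le (hp : p ≠ ⊤) :
    ∃ C, ∀ k, ∀ f : Lp ℂ p (volume : Measure (Rn n)), ‖opLp p (cutoff n k) f‖ ≤ C * ‖f‖ := by
  refine ⟨(∫⁻ x, ‖(𝓕⁻ (isTestFun_bump n).rescale.toSchwartz) x‖ₑ).toReal, fun k f => ?_⟩
  refine LinearMap.norm_extendOfNorm_apply_le (e := schwartzToLp n p) (denseRange_toLp hp) _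
    (fun φ => ?_) f
  have h := ((isTestFun_bump n).rescale.comp_smul (c := ((2 : ℝ) ^ k)⁻¹)
    (by positivity)).norm_toLp_fourierMultiplierCLM_le (p := p) hp φ
  rw [(isTestFun_bump n).rescale.lintegral_fourierInv_comp_smul (by positivity)] at h
  rw [opSchwartzToLp_apply, schwartzToLp_apply, rescale_cutoff]
  exact h

/-- Convergence holds on the dense Schwartz space and carries over to `Lᵖ` by the uniform bound,
with the usual `ε/3` argument. -/
theorem tendsto_opLp_cutoff (hp : p ≠ ⊤) (f : Lp ℂ p (volume : Measure (Rn n))) :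
    Tendsto (fun k => opLp p (cutoff n k) f) atTop (𝓝 f) := by
  obtain ⟨C, hC⟩ := exists_norm_opLp_cutoff_le (n := n) hp
  have hC' : ∀ k, ∀ f : Lp ℂ p (volume : Measure (Rn n)),
      ‖opLp p (cutoff n k) f‖ ≤ max C 1 * ‖f‖ := fun k f =>
    (hC k f).trans (mul_le_mul_of_nonneg_right (le_max_left _ _) (norm_nonneg f))
  rw [Metric.tendsto_atTop']
  intro ε hε
  obtain ⟨φ, hφ⟩ := (denseRange_toLp hp).exists_dist_lt f
    (show 0 < ε / (3 * max C 1) by positivity)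
  have hlim : Tendsto (fun k => opLp p (cutoff n k) (φ.toLp p)) atTop (𝓝 (φ.toLp p)) := by
    simp only [opLp_toLp hp (isTestFun_cutoff n _)]
    exact ((SchwartzMap.toLpCLM ℂ ℂ p (volume : Measure (Rn n))).continuous.tendsto φ).comp
      (tendsto_fourierMultiplierCLM_cutoff φ)
  obtain ⟨K, hK⟩ := Metric.tendsto_atTop'.1 hlim (ε / 3) (by positivity)
  refine ⟨K, fun k hk => ?_⟩
  have h1 : dist (opLp p (cutoff n k) f) (opLp p (cutoff n k) (φ.toLp p)) < ε / 3 := by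
    rw [dist_eq_norm, ← map_sub]
    calc _ ≤ max C 1 * ‖f - φ.toLp p volume‖ := hC' k _
      _ < max C 1 * (ε / (3 * max C 1)) := by
        rw [← dist_eq_norm]
        rw [schwartzToLp_apply] at hφ
        gcongr
      _ = ε / 3 := by field_simp
  have h2 : dist (φ.toLp p (volume : Measure (Rn n))) f < ε / 3 := by
    rw [dist_comm]
    refine hφ.trans_le (div_le_div_of_nonneg_left hε.le (by norm_num) ?_)
    linarith [le_max_right C 1]
  calc _ ≤ _ := dist_triangle4 _ (opLp p (cutoff n k) (φ.toLp p)) (φ.toLp p) f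
    _ < ε := by linarith [hK k hk]

end Extension

end ScalarMultipliers

/-! ### The frequency cutoffs truncate `op[a]` on products of Bessel potential spaces. -/

section TruncatedSystems

open Filter Topology

variable {n N : ℕ} {p : ℝ≥0∞} [Fact (1 ≤ p)]

/-! ### Composition of multipliers -/

theorem op_op {m₁ m₂ : Rn n → ℂ} (h₁ : m₁.HasTemperateGrowth) (h₂ : m₂.HasTemperateGrowth)
    (u : 𝓢'(Rn n, ℂ)) : op m₁ (op m₂ u) = op (fun ξ => m₁ ξ * m₂ ξ) u := by
  rw [op, op, TemperedDistribution.fourierMultiplierCLM_fourierMultiplierCLM_apply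
    (rescale_hasTemperateGrowth h₂) (rescale_hasTemperateGrowth h₁), mul_comm]
  rfl

theorem hasTemperateGrowth_mul {m₁ m₂ : Rn n → ℂ} (h₁ : m₁.HasTemperateGrowth)
    (h₂ : m₂.HasTemperateGrowth) : (fun ξ => m₁ ξ * m₂ ξ).HasTemperateGrowth := h₁.mul h₂

theorem op_zero : op (fun _ : Rn n => (0 : ℂ)) = 0 := by
  have h := TemperedDistribution.fourierMultiplierCLM_const (E := Rn n) (F := ℂ) 0
  rw [zero_smul] at h
  exact h

theorem op_sum {ι : Type*} (t : Finset ι) {m : ι → Rn n → ℂ}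
    (h : ∀ i ∈ t, (m i).HasTemperateGrowth) (u : 𝓢'(Rn n, ℂ)) :
    op (fun ξ => ∑ i ∈ t, m i ξ) u = ∑ i ∈ t, op (m i) u := by
  have h := TemperedDistribution.fourierMultiplierCLM_sum ℂ
    (fun i hi => rescale_hasTemperateGrowth (h i hi))
  have h' := congrArg (fun L => L u) h
  rw [_root_.sum_apply] at h'
  exact h'

theorem contDiff_bracket_rpow (n : ℕ) (s : ℝ) :
    ContDiff ℝ ∞ fun ξ : Rn n => ((bracket ξ ^ s : ℝ) : ℂ) :=
  (bracket_rpow_hasTemperateGrowth n s).1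

theorem opSystem_apply (a : Rn n → Matrix (Fin N) (Fin N) ℂ) (u : Fin N → 𝓢'(Rn n, ℂ))
    (i : Fin N) : opSystem a u i = ∑ j, op (fun ξ => a ξ i j) (u j) := by
  simp [opSystem]

theorem opSystem_opSystem {a b : Rn n → Matrix (Fin N) (Fin N) ℂ}
    (ha : ∀ i j, (fun ξ => a ξ i j).HasTemperateGrowth)
    (hb : ∀ i j, (fun ξ => b ξ i j).HasTemperateGrowth) (u : Fin N → 𝓢'(Rn n, ℂ)) :
    opSystem a (opSystem b u) = opSystem (fun ξ => a ξ * b ξ) u := by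
  funext i
  simp only [opSystem_apply, map_sum, Matrix.mul_apply]
  rw [Finset.sum_comm]
  refine Finset.sum_congr rfl fun j _ => ?_
  rw [op_sum _ fun l _ => hasTemperateGrowth_mul (ha i l) (hb l j)]
  exact Finset.sum_congr rfl fun l _ => op_op (ha i l) (hb l j) _

/-! ### Multipliers in `C_c^∞` on Bessel potential spaces -/

/-- `op[m] : H_p^s → H_p^{s'}` for `m ∈ C_c^∞`. -/
def opBessel (m : Rn n → ℂ) (s s' : ℝ) : BesselSpace n p s →L[ℂ] BesselSpace n p s' :=
  (BesselSpace.toLpEquiv (s := s')).symm.toContinuousLinearEquiv.toContinuousLinearMap ∘L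
    opLp p (fun ξ => m ξ * ((bracket ξ ^ s' : ℝ) * (bracket ξ ^ (-s) : ℝ))) ∘L
      (BesselSpace.toLpEquiv (s := s)).toContinuousLinearEquiv.toContinuousLinearMap

theorem toDist_opBessel (hp : p ≠ ⊤) {m : Rn n → ℂ} (hm : IsTestFun m) {s s' : ℝ}
    (u : BesselSpace n p s) :
    BesselSpace.toDist (opBessel m s s' u) = op m (BesselSpace.toDist u) := by
  have h1 : BesselSpace.toLp (opBessel m s s' u) = opLp p
      (fun ξ => m ξ * ((bracket ξ ^ s' : ℝ) * (bracket ξ ^ (-s) : ℝ))) (BesselSpace.toLp u) :=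
    LinearIsometryEquiv.apply_symm_apply (BesselSpace.toLpEquiv (s := s')) _
  have hw := hm.mul_contDiff ((contDiff_bracket_rpow n s').mul (contDiff_bracket_rpow n (-s)))
  have hb := bracket_rpow_hasTemperateGrowth n
  rw [BesselSpace.toDist_eq, h1, lpEmb_opLp hp hw, BesselSpace.lpEmb_toLp, bessel, bessel,
    op_op hw.hasTemperateGrowth (hb s), op_op (hb (-s')) (hasTemperateGrowth_mul hw.hasTemperateGrowth (hb s))]
  congr 2
  funext ξ
  have h2 : ∀ r : ℝ, ((bracket ξ ^ r : ℝ) : ℂ) ≠ 0 := fun r =>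
    Complex.ofReal_ne_zero.2 (Real.rpow_pos_of_pos (bracket_pos ξ) r).ne'
  have := h2 s
  have := h2 s'
  simp only [Real.rpow_neg (bracket_pos ξ).le, Complex.ofReal_inv]
  field_simp

/-- Scalar multipliers commute with Bessel potentials, so the cutoffs act on `H_p^s` as they do on
`Lᵖ`, and their strong convergence is inherited. -/
theorem toLp_eq_opLp (hp : p ≠ ⊤) {m : Rn n → ℂ} (hm : IsTestFun m) {s : ℝ}
    {u v : BesselSpace n p s} (h : BesselSpace.toDist v = op m (BesselSpace.toDist u)) :
    BesselSpace.toLp v = opLp p m (BesselSpace.toLp u) := by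
  have hb := bracket_rpow_hasTemperateGrowth n s
  apply lpEmb_injective
  rw [lpEmb_opLp hp hm, BesselSpace.lpEmb_toLp, BesselSpace.lpEmb_toLp, h, bessel,
    op_op hb hm.hasTemperateGrowth, op_op hm.hasTemperateGrowth hb]
  simp only [mul_comm]

/-- Matrix functions with entries in `C_c^∞`. -/
def IsMatrixTestFun (m : Rn n → Matrix (Fin N) (Fin N) ℂ) : Prop :=
  ∀ i j, IsTestFun fun ξ => m ξ i j

theorem IsMatrixTestFun.hasTemperateGrowth {m : Rn n → Matrix (Fin N) (Fin N) ℂ}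
    (hm : IsMatrixTestFun m) (i j : Fin N) : (fun ξ => m ξ i j).HasTemperateGrowth :=
  (hm i j).hasTemperateGrowth

/-- `op[m]` in `∏ⱼ H_p^{sⱼ}` for `m` with entries in `C_c^∞`. -/
def opProd (p : ℝ≥0∞) [Fact (1 ≤ p)] (s : Fin N → ℝ) (m : Rn n → Matrix (Fin N) (Fin N) ℂ) :
    BesselProd n p s →L[ℂ] BesselProd n p s :=
  ContinuousLinearMap.pi fun i => ∑ j, opBessel (fun ξ => m ξ i j) (s j) (s i) ∘L
    ContinuousLinearMap.proj j

/-- Since the inclusion into distributions is injective, this turns identities between operators on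
`X` into identities between symbols. -/
theorem prodToDist_opProd (hp : p ≠ ⊤) {s : Fin N → ℝ} {m : Rn n → Matrix (Fin N) (Fin N) ℂ}
    (hm : IsMatrixTestFun m) (x : BesselProd n p s) :
    prodToDist (opProd p s m x) = opSystem m (prodToDist x) := by
  funext i
  rw [opSystem_apply]
  change BesselSpace.toDist (opProd p s m x i) = ∑ j, op _ (BesselSpace.toDist (x j))
  simp only [opProd, ContinuousLinearMap.coe_pi', _root_.sum_apply,
    ContinuousLinearMap.comp_apply, ContinuousLinearMap.proj_apply, map_sum,
    toDist_opBessel hp (hm i _)]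

/-! ### Truncations of `op[a]` -/

variable {μ : ℝ} {a : Rn n → Matrix (Fin N) (Fin N) ℂ}

/-- The symbol `χ_k • 1` of the dyadic frequency cutoff. -/
def cutoffMatrix (n N k : ℕ) (ξ : Rn n) : Matrix (Fin N) (Fin N) ℂ := cutoff n k ξ • 1

/-- The truncated symbol `χ_{k+1} a`. -/
def truncatedSymbol (a : Rn n → Matrix (Fin N) (Fin N) ℂ) (k : ℕ) (ξ : Rn n) :
    Matrix (Fin N) (Fin N) ℂ := cutoff n (k + 1) ξ • a ξ

theorem isMatrixTestFun_cutoffMatrix (n N k : ℕ) : IsMatrixTestFun (cutoffMatrix n N k) :=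
  fun i j => (isTestFun_cutoff n k).mul_contDiff
    (h := fun _ => (1 : Matrix (Fin N) (Fin N) ℂ) i j) contDiff_const

theorem IsMatrixSymbol.isMatrixTestFun_truncatedSymbol (ha : IsMatrixSymbol μ a) (k : ℕ) :
    IsMatrixTestFun (truncatedSymbol a k) :=
  fun i j => (isTestFun_cutoff n (k + 1)).mul_contDiff (ha i j).1

/-- The shifted index in `truncatedSymbol` matters here: `χ_{k+1} χ_k = χ_k`, while `χ_k² ≠ χ_k` in
general. -/
theorem mul_cutoffMatrix (k : ℕ) (ξ : Rn n) :
    a ξ * cutoffMatrix n N k ξ = truncatedSymbol a k ξ * cutoffMatrix n N k ξ := by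
  simp [cutoffMatrix, truncatedSymbol, smul_smul, mul_comm (cutoff n k ξ),
    cutoff_mul_cutoff k.lt_succ_self]

theorem cutoffMatrix_commute (k : ℕ) (ξ : Rn n) (m : Matrix (Fin N) (Fin N) ℂ) :
    Commute (cutoffMatrix n N k ξ) m :=
  (Commute.one_left m).smul_left _

theorem opSystem_cutoffMatrix (k : ℕ) (u : Fin N → 𝓢'(Rn n, ℂ)) (i : Fin N) :
    opSystem (cutoffMatrix n N k) u i = op (cutoff n k) (u i) := by
  rw [opSystem_apply, Finset.sum_eq_single i]
  · simp [cutoffMatrix]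
  · intro j _ hj
    simp [cutoffMatrix, hj.symm, op_zero]
  · simp

theorem toLp_opProd_cutoffMatrix (hp : p ≠ ⊤) {s : Fin N → ℝ} (k : ℕ) (x : BesselProd n p s)
    (i : Fin N) : BesselSpace.toLp (opProd p s (cutoffMatrix n N k) x i) =
      opLp p (cutoff n k) (BesselSpace.toLp (x i)) := by
  refine toLp_eq_opLp hp (isTestFun_cutoff n k) ?_
  have h := congrFun (prodToDist_opProd hp (isMatrixTestFun_cutoffMatrix n N k) x) i
  rw [opSystem_cutoffMatrix] at h
  exact h

theorem tendsto_opProd_cutoffMatrix (hp : p ≠ ⊤) {s : Fin N → ℝ} (x : BesselProd n p s) :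
    Tendsto (fun k => opProd p s (cutoffMatrix n N k) x) atTop (𝓝 x) := by
  refine tendsto_pi_nhds.2 fun i => ?_
  rw [(BesselSpace.toLpEquiv (n := n) (p := p) (s := s i)).isometry.isEmbedding.tendsto_nhds_iff]
  exact (tendsto_opLp_cutoff hp (BesselSpace.toLp (x i))).congr fun k =>
    (toLp_opProd_cutoffMatrix hp k x i).symm

theorem isTruncation_realization (hp : p ≠ ⊤) (s : Fin N → ℝ) (ha : IsMatrixSymbol μ a) :
    IsTruncation (realization p s a) (fun k => opProd p s (cutoffMatrix n N k))
      (fun k => opProd p s (truncatedSymbol a k)) := by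
  have hP := isMatrixTestFun_cutoffMatrix n N
  have hB := ha.isMatrixTestFun_truncatedSymbol
  have ha' : ∀ i j, (fun ξ => a ξ i j).HasTemperateGrowth := fun i j => (ha i j).hasTemperateGrowth
  have hPx : ∀ k x, opSystem a (prodToDist (opProd p s (cutoffMatrix n N k) x)) =
      prodToDist (opProd p s (truncatedSymbol a k) (opProd p s (cutoffMatrix n N k) x)) := by
    intro k x
    rw [prodToDist_opProd hp (hB k), prodToDist_opProd hp (hP k),
      opSystem_opSystem ha' (hP k).hasTemperateGrowth,
      opSystem_opSystem (hB k).hasTemperateGrowth (hP k).hasTemperateGrowth]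
    exact congrArg (fun m => opSystem m (prodToDist x)) (funext fun ξ => mul_cutoffMatrix k ξ)
  refine ⟨tendsto_opProd_cutoffMatrix hp, fun k x => ?_, fun k x => ?_, fun k => ?_,
    fun j k hjk x => ?_⟩
  · refine ⟨⟨_, (hPx k x).symm⟩, prodToDist_injective ?_⟩
    rw [prodToDist_realization, hPx]
  · apply prodToDist_injective
    rw [← hPx, prodToDist_opProd hp (hP k), prodToDist_opProd hp (hP k), prodToDist_realization,
      opSystem_opSystem ha' (hP k).hasTemperateGrowth,
      opSystem_opSystem (hP k).hasTemperateGrowth ha']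
    simp only [(cutoffMatrix_commute k _ _).eq]
  · refine ContinuousLinearMap.ext fun x => prodToDist_injective ?_
    simp only [mul_apply_eq_comp]
    rw [prodToDist_opProd hp (hP k), prodToDist_opProd hp (hB k), prodToDist_opProd hp (hB k),
      prodToDist_opProd hp (hP k),
      opSystem_opSystem (hB k).hasTemperateGrowth (hP k).hasTemperateGrowth,
      opSystem_opSystem (hP k).hasTemperateGrowth (hB k).hasTemperateGrowth]
    simp only [(cutoffMatrix_commute k _ _).eq]
  · apply prodToDist_injective
    rw [prodToDist_opProd hp (hP k), prodToDist_opProd hp (hP j),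
      opSystem_opSystem (hP k).hasTemperateGrowth (hP j).hasTemperateGrowth]
    congr 2
    funext ξ
    simp [cutoffMatrix, smul_smul, mul_comm (cutoff n j ξ), cutoff_mul_cutoff hjk]

end TruncatedSystems

/-! ### The exponential of a truncated operator is a Fourier multiplier. -/

section Exponentials

open Filter Topology

variable {n N : ℕ} {p : ℝ≥0∞} [Fact (1 ≤ p)]

/-! ### Vector-valued Schwartz functions and their coordinates -/

theorem norm_le_sum_norm (v : CN N) : ‖v‖ ≤ ∑ i, ‖v i‖ := by
  rw [EuclideanSpace.norm_eq, Real.sqrt_le_left (Finset.sum_nonneg fun i _ => norm_nonneg _)]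
  exact Finset.sum_sq_le_sq_sum_of_nonneg fun i _ => norm_nonneg _

theorem norm_toLp_mulVec_le {M : Matrix (Fin N) (Fin N) ℂ} {C : ℝ} (h : ∀ i j, ‖M i j‖ ≤ C)
    (v : CN N) : ‖WithLp.toLp 2 (M *ᵥ v.ofLp)‖ ≤ N * (N * C) * ‖v‖ := by
  refine (norm_le_sum_norm _).trans ?_
  calc ∑ i, ‖(M *ᵥ v.ofLp) i‖ ≤ ∑ _i : Fin N, ∑ _j : Fin N, C * ‖v‖ := by
        refine Finset.sum_le_sum fun i _ => (norm_sum_le Finset.univ fun j => M i j * v j).trans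
          (Finset.sum_le_sum fun j _ => ?_)
        rw [norm_mul]
        exact mul_le_mul (h i j) (PiLp.norm_apply_le v j) (norm_nonneg _)
          ((norm_nonneg _).trans (h i j))
    _ = _ := by simp; ring

/-- The `j`-th coordinate of a vector-valued Schwartz function. -/
def coord (j : Fin N) : 𝓢(Rn n, CN N) →L[ℂ] 𝓢(Rn n, ℂ) :=
  SchwartzMap.postcompCLM (EuclideanSpace.proj j : CN N →L[ℂ] ℂ)

theorem coord_apply (j : Fin N) (u : 𝓢(Rn n, CN N)) (x : Rn n) : coord j u x = u x j := rfl

theorem fourier_coord (j : Fin N) (u : 𝓢(Rn n, CN N)) : 𝓕 (coord j u) = coord j (𝓕 u) := by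
  ext η
  rw [coord_apply, SchwartzMap.fourier_coe, SchwartzMap.fourier_coe, Real.fourier_eq,
    Real.fourier_eq]
  have h := (EuclideanSpace.proj j : CN N →L[ℂ] ℂ).integral_comp_comm
    ((Real.fourierIntegral_convergent_iff η).2 (u.integrable (μ := volume)))
  exact h

theorem fourier_injective : Function.Injective fun φ : 𝓢(Rn n, ℂ) => (𝓕 φ : 𝓢(Rn n, ℂ)) :=
  Function.LeftInverse.injective (g := fun ψ : 𝓢(Rn n, ℂ) => (𝓕⁻ ψ : 𝓢(Rn n, ℂ)))
    fun φ => FourierTransform.fourierInv_fourier_eq φ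

theorem coord_fourierMultiplierCLM {g : Rn n → ℂ} (hg : g.HasTemperateGrowth) (j : Fin N)
    (u : 𝓢(Rn n, CN N)) : coord j (SchwartzMap.fourierMultiplierCLM (CN N) g u) =
      SchwartzMap.fourierMultiplierCLM ℂ g (coord j u) := by
  apply fourier_injective
  beta_reduce
  rw [fourier_coord, SchwartzMap.fourierMultiplierCLM_apply, SchwartzMap.fourierMultiplierCLM_apply,
    FourierTransform.fourier_fourierInv_eq, FourierTransform.fourier_fourierInv_eq, fourier_coord]
  ext η
  simp [coord_apply, SchwartzMap.smulLeftCLM_apply_apply hg]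

theorem integrable_symbol_mulVec {m : Rn n → Matrix (Fin N) (Fin N) ℂ} (hm : Continuous m)
    {u : 𝓢(Rn n, CN N)} {C : ℝ} (hC : ∀ η, 𝓕 u η ≠ 0 → ∀ i j, ‖rescale m η i j‖ ≤ C) :
    Integrable fun η : Rn n => WithLp.toLp 2 (rescale m η *ᵥ (𝓕 u η).ofLp) := by
  have hu : Integrable fun η => (N * (N * C)) * ‖𝓕 u η‖ :=
    ((𝓕 u).integrable (μ := volume)).norm.const_mul _
  refine hu.mono' (Continuous.aestronglyMeasurable ?_) (Eventually.of_forall fun η => ?_)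
  · refine (PiLp.continuous_toLp 2 _).comp (Continuous.matrix_mulVec (hm.comp (by fun_prop)) ?_)
    exact (PiLp.continuous_ofLp 2 _).comp (𝓕 u).continuous
  · by_cases h : 𝓕 u η = 0
    · simp [h]
    · exact norm_toLp_mulVec_le (hC η h) _

theorem multiplierOp_apply {m : Rn n → Matrix (Fin N) (Fin N) ℂ} {u : 𝓢(Rn n, CN N)}
    (h : Integrable fun η : Rn n => WithLp.toLp 2 (rescale m η *ᵥ (𝓕 u η).ofLp)) (x : Rn n)
    (i : Fin N) : multiplierOp m u x i =
      ∫ η, Real.fourierChar (inner ℝ η x) • (rescale m η *ᵥ (𝓕 u η).ofLp) i := by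
  rw [multiplierOp, Real.fourierInv_eq]
  have h1 : Integrable fun η : Rn n => Real.fourierChar (inner ℝ η x) •
      WithLp.toLp 2 (rescale m η *ᵥ (𝓕 u η).ofLp) := by
    simpa using (Real.fourierIntegral_convergent_iff (-x)).2 h
  have h2 := (EuclideanSpace.proj i : CN N →L[ℂ] ℂ).integral_comp_comm h1
  exact h2.symm

theorem multiplierOp_congr {m m' : Rn n → Matrix (Fin N) (Fin N) ℂ} {u : 𝓢(Rn n, CN N)}
    (h : ∀ η, 𝓕 u η ≠ 0 → rescale m η = rescale m' η) : multiplierOp m u = multiplierOp m' u := by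
  rw [multiplierOp, multiplierOp]
  congr 1
  funext η
  by_cases h0 : 𝓕 u η = 0
  · simp [h0]
  · rw [h η h0]

/-! ### The exponential of a truncated symbol -/

/-- The symbol `Λ m Λ⁻¹`. -/
def conjSymbol (s : Fin N → ℝ) (m : Rn n → Matrix (Fin N) (Fin N) ℂ) (ξ : Rn n) :
    Matrix (Fin N) (Fin N) ℂ := weight s ξ * m ξ * (weight s ξ)⁻¹

theorem weight_inv (s : Fin N → ℝ) (ξ : Rn n) : (weight s ξ)⁻¹ = weight (fun j => -s j) ξ := by
  refine Matrix.inv_eq_left_inv ?_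
  rw [weight, weight, Matrix.diagonal_mul_diagonal, ← Matrix.diagonal_one]
  congr 1
  funext j
  rw [← Complex.ofReal_mul, ← Real.rpow_add (bracket_pos ξ), neg_add_cancel, Real.rpow_zero,
    Complex.ofReal_one]

theorem isUnit_weight (s : Fin N → ℝ) (ξ : Rn n) : IsUnit (weight s ξ) := by
  rw [weight, Matrix.isUnit_diagonal, Pi.isUnit_iff]
  exact fun j => (Complex.ofReal_ne_zero.2 (Real.rpow_pos_of_pos (bracket_pos ξ) _).ne').isUnit

theorem conjSymbol_apply (s : Fin N → ℝ) (m : Rn n → Matrix (Fin N) (Fin N) ℂ) (ξ : Rn n)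
    (i j : Fin N) : conjSymbol s m ξ i j =
      m ξ i j * ((bracket ξ ^ s i : ℝ) * (bracket ξ ^ (-s j) : ℝ)) := by
  rw [conjSymbol, weight_inv, weight, weight, Matrix.mul_diagonal, Matrix.diagonal_mul]
  ring

theorem IsMatrixTestFun.conjSymbol {m : Rn n → Matrix (Fin N) (Fin N) ℂ} (hm : IsMatrixTestFun m)
    (s : Fin N → ℝ) : IsMatrixTestFun (conjSymbol s m) := fun i j => by
  simp only [conjSymbol_apply]
  exact (hm i j).mul_contDiff ((contDiff_bracket_rpow n (s i)).mul (contDiff_bracket_rpow n (-s j)))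

/-- Conjugation by an invertible matrix passes through the exponential. -/
theorem conjugatedExp_eq_exp (s : Fin N → ℝ) (m : Rn n → Matrix (Fin N) (Fin N) ℂ) (t : ℝ)
    (ξ : Rn n) : conjugatedExp s m t ξ = NormedSpace.exp ((t : ℂ) • conjSymbol s m ξ) := by
  rw [conjugatedExp, ← Matrix.exp_conj _ _ (isUnit_weight s ξ), conjSymbol]
  congr 1
  simp

/-- The inclusion of `Λ⁻¹ 𝓢(ℝⁿ)ᴺ` in `∏ⱼ H_p^{sⱼ}`. -/
def embed (p : ℝ≥0∞) [Fact (1 ≤ p)] (s : Fin N → ℝ) :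
    (Fin N → 𝓢(Rn n, ℂ)) →ₗ[ℂ] BesselProd n p s :=
  LinearMap.pi fun j => (BesselSpace.toLpEquiv (s := s j)).symm.toLinearEquiv.toLinearMap ∘ₗ
    schwartzToLp n p ∘ₗ LinearMap.proj j

theorem toLp_embed (s : Fin N → ℝ) (Φ : Fin N → 𝓢(Rn n, ℂ)) (j : Fin N) :
    BesselSpace.toLp (embed p s Φ j) = (Φ j).toLp p :=
  LinearIsometryEquiv.apply_symm_apply (BesselSpace.toLpEquiv (s := s j)) _

theorem toDist_embed (s : Fin N → ℝ) (Φ : Fin N → 𝓢(Rn n, ℂ)) (j : Fin N) :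
    BesselSpace.toDist (embed p s Φ j) = bessel n (-s j) (Φ j : 𝓢'(Rn n, ℂ)) := by
  rw [BesselSpace.toDist_eq, toLp_embed, lpEmb_schwartz]

/-- In the coordinates given by `Λ`, the operator `op[m]` becomes `op[Λ m Λ⁻¹]` and preserves the
Schwartz space; its powers can therefore be computed on the Fourier side. -/
theorem opProd_embed (hp : p ≠ ⊤) (s : Fin N → ℝ) {m : Rn n → Matrix (Fin N) (Fin N) ℂ}
    (hm : IsMatrixTestFun m) (Φ : Fin N → 𝓢(Rn n, ℂ)) :
    opProd p s m (embed p s Φ) = embed p s fun i => ∑ j,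
      SchwartzMap.fourierMultiplierCLM ℂ (rescale fun ξ => conjSymbol s m ξ i j) (Φ j) := by
  apply prodToDist_injective
  rw [prodToDist_opProd hp hm]
  funext i
  have hb := bracket_rpow_hasTemperateGrowth n
  have hw := fun j => (hm.conjSymbol s i j).hasTemperateGrowth
  rw [opSystem_apply]
  change ∑ j, op _ (BesselSpace.toDist (embed p s Φ j)) = BesselSpace.toDist (embed p s _ i)
  rw [toDist_embed, map_sum, map_sum]
  refine Finset.sum_congr rfl fun j _ => ?_
  rw [toDist_embed, bessel, bessel, op_op (hm i j).hasTemperateGrowth (hb _)]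
  change _ = op _ ((SchwartzMap.fourierMultiplierCLM ℂ _ (Φ j) : 𝓢(Rn n, ℂ)) : 𝓢'(Rn n, ℂ))
  rw [← op_schwartz (hw j), op_op (hb _) (hw j)]
  congr 2
  funext ξ
  have h2 := Complex.ofReal_ne_zero.2 (Real.rpow_pos_of_pos (bracket_pos ξ) (s i)).ne'
  rw [conjSymbol_apply, Real.rpow_neg (bracket_pos ξ).le (s i), Complex.ofReal_inv]
  field_simp

/-- The vector `(𝓕 Φ₁(η), …, 𝓕 Φ_N(η))`. -/
def fourierVec (Φ : Fin N → 𝓢(Rn n, ℂ)) (η : Rn n) : Fin N → ℂ := fun j => 𝓕 (Φ j) η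

theorem fourierVec_zero (η : Rn n) : fourierVec (0 : Fin N → 𝓢(Rn n, ℂ)) η = 0 := by
  funext j
  have h : 𝓕 (0 : 𝓢(Rn n, ℂ)) = 0 := map_zero (FourierTransform.fourierCLM ℂ 𝓢(Rn n, ℂ))
  simp [fourierVec, h]

theorem fourierVec_add (Φ Ψ : Fin N → 𝓢(Rn n, ℂ)) (η : Rn n) :
    fourierVec (Φ + Ψ) η = fourierVec Φ η + fourierVec Ψ η := by
  funext j
  simp [fourierVec, FourierTransform.fourier_add]

theorem fourierVec_smul (c : ℂ) (Φ : Fin N → 𝓢(Rn n, ℂ)) (η : Rn n) :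
    fourierVec (c • Φ) η = c • fourierVec Φ η := by
  funext j
  simp [fourierVec, FourierTransform.fourier_smul]

theorem fourierVec_fourierMultiplierCLM {w : Rn n → Matrix (Fin N) (Fin N) ℂ}
    (hw : IsMatrixTestFun w) (Φ : Fin N → 𝓢(Rn n, ℂ)) (η : Rn n) :
    fourierVec (fun i => ∑ j,
      SchwartzMap.fourierMultiplierCLM ℂ (rescale fun ξ => w ξ i j) (Φ j)) η =
      rescale w η *ᵥ fourierVec Φ η := by
  funext i
  have h : ∀ φ : Fin N → 𝓢(Rn n, ℂ), 𝓕 (∑ j, φ j) = ∑ j, 𝓕 (φ j) := fun φ =>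
    map_sum (FourierTransform.fourierCLM ℂ 𝓢(Rn n, ℂ)) φ Finset.univ
  simp only [fourierVec, h, SchwartzMap.fourierMultiplierCLM_apply,
    FourierTransform.fourier_fourierInv_eq, _root_.sum_apply]
  refine Finset.sum_congr rfl fun j _ => ?_
  rw [SchwartzMap.smulLeftCLM_apply_apply
    (rescale_hasTemperateGrowth (hw.hasTemperateGrowth i j)), smul_eq_mul]
  rfl

/-- The partial sums of the exponential series of `t op[m]`, applied to `Λ⁻¹ 𝓢(ℝⁿ)ᴺ`. -/
theorem exists_embed_eq_sum (hp : p ≠ ⊤) (s : Fin N → ℝ) {m : Rn n → Matrix (Fin N) (Fin N) ℂ}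
    (hm : IsMatrixTestFun m) (Φ : Fin N → 𝓢(Rn n, ℂ)) (t : ℂ) (L : ℕ) :
    ∃ Ψ : Fin N → 𝓢(Rn n, ℂ),
      (∑ l ∈ Finset.range L, ((l.factorial : ℂ)⁻¹ • (t • opProd p s m) ^ l)) (embed p s Φ) =
        embed p s Ψ ∧
      ∀ η, fourierVec Ψ η = (∑ l ∈ Finset.range L,
        ((l.factorial : ℂ)⁻¹ • (t • rescale (conjSymbol s m) η) ^ l)) *ᵥ fourierVec Φ η := by
  have hpow : ∀ l : ℕ, ∃ Ψ : Fin N → 𝓢(Rn n, ℂ),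
      ((t • opProd p s m) ^ l) (embed p s Φ) = embed p s Ψ ∧
      ∀ η, fourierVec Ψ η = (t • rescale (conjSymbol s m) η) ^ l *ᵥ fourierVec Φ η := by
    intro l
    induction l with
    | zero => exact ⟨Φ, by simp, fun η => by simp⟩
    | succ l ih =>
      obtain ⟨Ψ, h1, h2⟩ := ih
      refine ⟨t • fun i => ∑ j, SchwartzMap.fourierMultiplierCLM ℂ
        (rescale fun ξ => conjSymbol s m ξ i j) (Ψ j), ?_, fun η => ?_⟩
      · rw [pow_succ', mul_apply_eq_comp, h1, _root_.smul_apply, opProd_embed hp s hm, map_smul]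
      · rw [fourierVec_smul, fourierVec_fourierMultiplierCLM (hm.conjSymbol s), h2, pow_succ',
          ← Matrix.mulVec_mulVec, Matrix.smul_mulVec]
  induction L with
  | zero => exact ⟨0, by simp, fun η => by simp [fourierVec_zero]⟩
  | succ L ih =>
    obtain ⟨Ψ, h1, h2⟩ := ih
    obtain ⟨Ψ', h1', h2'⟩ := hpow L
    refine ⟨Ψ + (L.factorial : ℂ)⁻¹ • Ψ', ?_, fun η => ?_⟩
    · rw [Finset.sum_range_succ, _root_.add_apply, h1, _root_.smul_apply, h1', map_add, map_smul]
    · rw [Finset.sum_range_succ, fourierVec_add, fourierVec_smul, h2, h2', Matrix.add_mulVec,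
        Matrix.smul_mulVec]

theorem IsMatrixTestFun.exists_norm_le {w : Rn n → Matrix (Fin N) (Fin N) ℂ}
    (hw : IsMatrixTestFun w) : ∃ C, ∀ ξ i j, ‖w ξ i j‖ ≤ C := by
  choose C hC using fun i j =>
    (hw i j).compact.exists_bound_of_continuous (hw i j).contDiff.continuous
  refine ⟨∑ i, ∑ j, |C i j|, fun ξ i j => (hC i j ξ).trans ((le_abs_self _).trans ?_)⟩
  calc |C i j| ≤ ∑ j, |C i j| :=
        Finset.single_le_sum (f := fun j => |C i j|) (fun _ _ => abs_nonneg _) (Finset.mem_univ j)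
    _ ≤ _ := Finset.single_le_sum (f := fun i => ∑ j, |C i j|)
        (fun _ _ => Finset.sum_nonneg fun _ _ => abs_nonneg _) (Finset.mem_univ i)

section MatrixNorm

open scoped Matrix.Norms.Operator

theorem norm_entry_le (M : Matrix (Fin N) (Fin N) ℂ) (i j : Fin N) : ‖M i j‖ ≤ ‖M‖ := by
  have h := Matrix.linfty_opNorm_mulVec M (Pi.single j 1)
  refine le_trans ?_ (h.trans (mul_le_of_le_one_right (norm_nonneg _) ?_))
  · simpa using norm_le_pi_norm (M *ᵥ Pi.single j 1) i
  · rw [pi_norm_le_iff_of_nonneg zero_le_one]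
    intro l
    by_cases hl : l = j
    · subst hl; simp
    · simp [hl]

theorem norm_le_of_entry_le {M : Matrix (Fin N) (Fin N) ℂ} {C : ℝ} (hC : 0 ≤ C)
    (h : ∀ i j, ‖M i j‖ ≤ C) : ‖M‖ ≤ N * C := by
  rw [Matrix.linfty_opNorm_def]
  have : (Finset.univ.sup fun i => ∑ j, ‖M i j‖₊) ≤ N * C.toNNReal := by
    refine Finset.sup_le fun i _ => (Finset.sum_le_sum fun j _ =>
      show ‖M i j‖₊ ≤ C.toNNReal from ?_).trans (by simp)
    rw [← NNReal.coe_le_coe, coe_nnnorm, Real.coe_toNNReal _ hC]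
    exact h i j
  refine (NNReal.coe_le_coe.2 this).trans ?_
  simp [hC]

theorem tendsto_sum_exp (M : Matrix (Fin N) (Fin N) ℂ) :
    Tendsto (fun L : ℕ => ∑ l ∈ Finset.range L, ((l.factorial : ℂ)⁻¹ • M ^ l)) atTop
      (𝓝 (NormedSpace.exp M)) :=
  (NormedSpace.exp_series_hasSum_exp' (𝕂 := ℂ) M).tendsto_sum_nat

/-- The bound does not depend on the number of terms, which makes it a majorant for dominated
convergence. -/
theorem norm_sum_exp_entry_le {M : Matrix (Fin N) (Fin N) ℂ} {C : ℝ} (hC : 0 ≤ C)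
    (h : ∀ i j, ‖M i j‖ ≤ C) (L : ℕ) (i j : Fin N) :
    ‖(∑ l ∈ Finset.range L, ((l.factorial : ℂ)⁻¹ • M ^ l)) i j‖ ≤ Real.exp (N * C) := by
  have : Nonempty (Fin N) := ⟨i⟩
  refine (norm_entry_le _ i j).trans ((norm_sum_le _ _).trans ?_)
  refine le_trans (Finset.sum_le_sum fun l _ => ?_)
    (Real.sum_le_exp_of_nonneg (show 0 ≤ N * C by positivity) L)
  rw [norm_smul, norm_inv, Complex.norm_natCast, div_eq_inv_mul]
  gcongr
  exact (norm_pow_le M l).trans (pow_le_pow_left₀ (norm_nonneg _) (norm_le_of_entry_le hC h) l)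

theorem continuous_exp_matrix :
    Continuous fun M : Matrix (Fin N) (Fin N) ℂ => NormedSpace.exp M := by
  let : NormedAlgebra ℚ (Matrix (Fin N) (Fin N) ℂ) := NormedAlgebra.restrictScalars ℚ ℂ _
  exact NormedSpace.exp_continuous

end MatrixNorm

theorem continuous_conjugatedExp (s : Fin N → ℝ) {m : Rn n → Matrix (Fin N) (Fin N) ℂ}
    (hm : Continuous m) (t : ℝ) : Continuous (conjugatedExp s m t) := by
  have hw : ∀ s : Fin N → ℝ, Continuous (weight (n := n) s) := fun s => by
    refine Continuous.matrix_diagonal (continuous_pi fun j => ?_)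
    exact (contDiff_bracket_rpow n (s j)).continuous
  have h : conjugatedExp s m t =
      fun ξ => NormedSpace.exp ((t : ℂ) • (weight s ξ * m ξ * weight (fun j => -s j) ξ)) := by
    funext ξ
    rw [conjugatedExp_eq_exp, conjSymbol, weight_inv]
  have hc : Continuous fun ξ => weight s ξ * m ξ * weight (fun j => -s j) ξ :=
    ((hw s).mul hm).mul (hw _)
  rw [h]
  exact continuous_exp_matrix.comp (hc.const_smul (t : ℂ))

/-- The partial sums of the exponential series, applied to `Λ⁻¹ u`, have two limits. In `Lᵖ` they
tend to the operator exponential, by convergence in operator norm; pointwise they tend to the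
multiplier with the matrix exponential as symbol, by dominated convergence in the Fourier integral.
The two limits agree almost everywhere. -/
theorem toLp_exp_opProd (hp : p ≠ ⊤) (s : Fin N → ℝ) {m : Rn n → Matrix (Fin N) (Fin N) ℂ}
    (hm : IsMatrixTestFun m) (t : ℝ) (u : 𝓢(Rn n, CN N)) (i : Fin N) :
    (BesselSpace.toLp (NormedSpace.exp ((t : ℂ) • opProd p s m) (embed p s (fun j => coord j u)) i) :
      Rn n → ℂ) =ᵐ[volume] fun x => multiplierOp (conjugatedExp s m t) u x i := by
  set Φ : Fin N → 𝓢(Rn n, ℂ) := fun j => coord j u with hΦ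
  have hvec : ∀ η, fourierVec Φ η = (𝓕 u η).ofLp := by
    intro η
    funext j
    rw [fourierVec, hΦ, fourier_coord, coord_apply]
  choose Ψ hΨ1 hΨ2 using exists_embed_eq_sum hp s hm Φ (t : ℂ)
  obtain ⟨C, hC⟩ := (hm.conjSymbol s).exists_norm_le
  have hC' : ∀ η i j, ‖((t : ℂ) • rescale (conjSymbol s m) η) i j‖ ≤ |t| * |C| := by
    intro η i j
    rw [Matrix.smul_apply, norm_smul, Complex.norm_real]
    exact mul_le_mul_of_nonneg_left ((hC _ i j).trans (le_abs_self C)) (abs_nonneg t)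
  have hexp : ∀ η, rescale (conjugatedExp s m t) η =
      NormedSpace.exp ((t : ℂ) • rescale (conjSymbol s m) η) := fun η => conjugatedExp_eq_exp s m t _
  have hmc : Continuous m := continuous_matrix fun i j => (hm i j).contDiff.continuous
  -- convergence in `Lᵖ`
  have h1 : Tendsto (fun L => (Ψ L i).toLp p volume) atTop (𝓝 (BesselSpace.toLp
      (NormedSpace.exp ((t : ℂ) • opProd p s m) (embed p s Φ) i))) := by
    have h := (NormedSpace.exp_series_hasSum_exp' (𝕂 := ℂ) ((t : ℂ) • opProd p s m)).tendsto_sum_nat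
    have h2 : Continuous fun B : BesselProd n p s →L[ℂ] BesselProd n p s =>
        BesselSpace.toLpEquiv (B (embed p s Φ) i) := by fun_prop
    have h3 := (h2.tendsto _).comp h
    refine h3.congr fun L => ?_
    simp only [Function.comp_apply]
    rw [hΨ1]
    exact toLp_embed s (Ψ L) i
  -- pointwise convergence
  have h2 : ∀ x, Tendsto (fun L => Ψ L i x) atTop
      (𝓝 (multiplierOp (conjugatedExp s m t) u x i)) := by
    intro x
    have hlim : ∀ η, Tendsto (fun L => fourierVec (Ψ L) η i) atTop
        (𝓝 ((rescale (conjugatedExp s m t) η *ᵥ (𝓕 u η).ofLp) i)) := by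
      intro η
      simp only [hΨ2, hvec]
      have hc : Continuous fun M : Matrix (Fin N) (Fin N) ℂ => (M *ᵥ (𝓕 u η).ofLp) i := by
        fun_prop
      rw [hexp]
      exact (hc.tendsto _).comp (tendsto_sum_exp _)
    have hb : ∀ L η, ‖fourierVec (Ψ L) η i‖ ≤
        N * (N * Real.exp (N * (|t| * |C|))) * ‖𝓕 u η‖ := by
      intro L η
      rw [hΨ2, hvec]
      exact (PiLp.norm_apply_le (WithLp.toLp 2 _ : CN N) i).trans
        (norm_toLp_mulVec_le (norm_sum_exp_entry_le (by positivity) (hC' η) L) _)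
    have hint : Integrable fun η : Rn n =>
        WithLp.toLp 2 (rescale (conjugatedExp s m t) η *ᵥ (𝓕 u η).ofLp) := by
      refine integrable_symbol_mulVec (continuous_conjugatedExp s hmc t)
        (C := Real.exp (N * (|t| * |C|))) fun η _ i j => ?_
      rw [hexp]
      have hc : Continuous fun M : Matrix (Fin N) (Fin N) ℂ => ‖M i j‖ := by fun_prop
      exact le_of_tendsto ((hc.tendsto _).comp (tendsto_sum_exp _)) (Eventually.of_forall fun L =>
        norm_sum_exp_entry_le (by positivity) (hC' η) L i j)
    have hΨx : ∀ L, Ψ L i x =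
        ∫ η, Real.fourierChar (inner ℝ η x) • fourierVec (Ψ L) η i := by
      intro L
      have h : (𝓕⁻ (𝓕 (Ψ L i)) : 𝓢(Rn n, ℂ)) = Ψ L i :=
        FourierTransform.fourierInv_fourier_eq _
      rw [← congrArg (fun φ : 𝓢(Rn n, ℂ) => φ x) h]
      beta_reduce
      rw [SchwartzMap.fourierInv_coe, Real.fourierInv_eq]
      rfl
    rw [multiplierOp_apply hint]
    simp only [hΨx]
    refine tendsto_integral_of_dominated_convergence
      (fun η => N * (N * Real.exp (N * (|t| * |C|))) * ‖𝓕 u η‖) (fun L => ?_)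
      (((𝓕 u).integrable (μ := volume)).norm.const_mul _) (fun L => Eventually.of_forall fun η => ?_)
      (Eventually.of_forall fun η => (hlim η).const_smul _)
    · have he : Continuous fun η : Rn n => Real.fourierChar (inner ℝ η x) :=
        Real.continuous_fourierChar.comp (Continuous.inner continuous_id continuous_const)
      exact (he.smul (𝓕 (Ψ L i)).continuous).aestronglyMeasurable
    · simpa using hb L η
  -- Convergence in `Lᵖ` gives almost everywhere convergence along a subsequence, enough to identify
  -- the limits.
  obtain ⟨ns, hns, hae⟩ := (tendstoInMeasure_of_tendsto_Lp h1).exists_seq_tendsto_ae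
  have hcoe : ∀ᵐ x, ∀ L, ((Ψ L i).toLp p volume : Rn n → ℂ) x = Ψ L i x :=
    ae_all_iff.2 fun L => (Ψ L i).coeFn_toLp p volume
  filter_upwards [hae, hcoe] with x hx hx'
  simp only [hx'] at hx
  exact tendsto_nhds_unique hx ((h2 x).comp hns.tendsto_atTop)

end Exponentials

/-! ### Bounds on band-limited functions control the symbol pointwise. -/

section BandLimited

open Filter Topology

variable {n N : ℕ} {p : ℝ≥0∞}

/-! ### Convergence and scaling of inverse Fourier integrals -/

section FourierInv

theorem eLpNorm_comp_smul {E : Type*} [NormedAddCommGroup E] (f : Rn n → E) {c : ℝ} (hc : 0 < c) :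
    eLpNorm (fun x => f (c • x)) p =
      ENNReal.ofReal (c ^ n)⁻¹ ^ (1 / p).toReal * eLpNorm f p := by
  have h1 : MeasurableEmbedding fun x : Rn n => c • x :=
    (Homeomorph.smulOfNeZero c hc.ne').measurableEmbedding
  have h2 := h1.eLpNorm_map_measure (g := f) (p := p) (μ := volume)
  rw [Measure.map_addHaar_smul _ hc.ne', finrank_euclideanSpace_fin,
    abs_of_pos (inv_pos.2 (pow_pos hc n)), eLpNorm_smul_measure_of_ne_zero
      (ENNReal.ofReal_pos.2 (inv_pos.2 (pow_pos hc n))).ne'] at h2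
  exact h2.symm

variable {E : Type*} [NormedAddCommGroup E] [NormedSpace ℂ E]

theorem continuous_fourierInv_of_integrable {f : Rn n → E} (hf : Integrable f) :
    Continuous (𝓕⁻ f) :=
  VectorFourier.fourierIntegral_continuous Real.continuous_fourierChar
    (by
      have h : Continuous fun q : Rn n × Rn n => -inner ℝ q.1 q.2 :=
        (continuous_fst.inner continuous_snd).neg
      simpa using h) hf

theorem aestronglyMeasurable_fourierChar_smul {f : Rn n → E} (hf : AEStronglyMeasurable f)
    (x : Rn n) : AEStronglyMeasurable fun η => Real.fourierChar (inner ℝ η x) • f η := by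
  have he : Continuous fun η : Rn n => Real.fourierChar (inner ℝ η x) :=
    Real.continuous_fourierChar.comp (Continuous.inner continuous_id continuous_const)
  exact he.aestronglyMeasurable.smul hf

theorem tendsto_fourierInv {f : ℕ → Rn n → E} {g : Rn n → E} {b : Rn n → ℝ}
    (hf : ∀ k, AEStronglyMeasurable (f k)) (hb : Integrable b) (hfb : ∀ k η, ‖f k η‖ ≤ b η)
    (h : ∀ η, Tendsto (fun k => f k η) atTop (𝓝 (g η))) (x : Rn n) :
    Tendsto (fun k => 𝓕⁻ (f k) x) atTop (𝓝 (𝓕⁻ g x)) := by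
  simp only [Real.fourierInv_eq]
  refine tendsto_integral_of_dominated_convergence b
    (fun k => aestronglyMeasurable_fourierChar_smul (hf k) x) hb
    (fun k => Eventually.of_forall fun η => ?_)
    (Eventually.of_forall fun η => (h η).const_smul _)
  simpa using hfb k η

/-- Dominated convergence of the integrands gives pointwise convergence of the inverse transforms,
to which Fatou's lemma applies. -/
theorem eLpNorm_fourierInv_le_of_tendsto {f : ℕ → Rn n → E} {g : Rn n → E} {b : Rn n → ℝ}
    (hf : ∀ k, AEStronglyMeasurable (f k)) (hb : Integrable b) (hfb : ∀ k η, ‖f k η‖ ≤ b η)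
    (h : ∀ η, Tendsto (fun k => f k η) atTop (𝓝 (g η))) {K : ℕ → ℝ≥0∞} {K₀ : ℝ≥0∞}
    (hK : ∀ k, eLpNorm (𝓕⁻ (f k)) p ≤ K k) (hK₀ : Tendsto K atTop (𝓝 K₀)) :
    eLpNorm (𝓕⁻ g) p ≤ K₀ := by
  refine (Lp.eLpNorm_lim_le_liminf_eLpNorm (fun k => (continuous_fourierInv_of_integrable
    (hb.mono' (hf k) (Eventually.of_forall (hfb k)))).aestronglyMeasurable) _
    (Eventually.of_forall (tendsto_fourierInv hf hb hfb h))).trans ?_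
  rw [← hK₀.liminf_eq]
  exact liminf_le_liminf (Eventually.of_forall hK)

theorem fourierInv_dilate (F : Rn n → E) {c : ℝ} (hc : 0 < c) (η₀ x : Rn n) :
    𝓕⁻ (fun η => F (c⁻¹ • (η - η₀))) x =
      (c ^ n) • Real.fourierChar (inner ℝ η₀ x) • 𝓕⁻ F (c • x) := by
  rw [Real.fourierInv_eq, Real.fourierInv_eq]
  have h1 : (fun η => Real.fourierChar (inner ℝ η x) • F (c⁻¹ • (η - η₀))) = fun η =>
      (fun ζ => Real.fourierChar (inner ℝ η₀ x) •
        Real.fourierChar (inner ℝ (c⁻¹ • ζ) (c • x)) • F (c⁻¹ • ζ)) (η - η₀) := by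
    funext η
    beta_reduce
    rw [real_inner_smul_left, real_inner_smul_right, inv_mul_cancel_left₀ hc.ne', inner_sub_left,
      smul_smul, ← AddChar.map_add_eq_mul, add_sub_cancel]
  rw [h1, integral_sub_right_eq_self (fun ζ => Real.fourierChar (inner ℝ η₀ x) •
        Real.fourierChar (inner ℝ (c⁻¹ • ζ) (c • x)) • F (c⁻¹ • ζ)) η₀,
    Measure.integral_comp_smul volume (fun ζ => Real.fourierChar (inner ℝ η₀ x) •
        Real.fourierChar (inner ℝ ζ (c • x)) • F ζ)]
  rw [finrank_euclideanSpace_fin, inv_pow, inv_inv, abs_of_pos (pow_pos hc n)]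
  congr 1
  simp only [Circle.smul_def]
  exact integral_smul _ _

/-- Translation in frequency is a modulation and leaves absolute values unchanged; dilation
contributes a factor independent of `F`, which cancels when two such norms are compared. -/
theorem exists_eLpNorm_fourierInv_dilate (n : ℕ) (E : Type*) [NormedAddCommGroup E]
    [NormedSpace ℂ E] (p : ℝ≥0∞) {c : ℝ} (hc : 0 < c) (η₀ : Rn n) :
    ∃ K : ℝ≥0∞, K ≠ 0 ∧ K ≠ ⊤ ∧ ∀ F : Rn n → E,
      eLpNorm (𝓕⁻ fun η => F (c⁻¹ • (η - η₀))) p = K * eLpNorm (𝓕⁻ F) p := by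
  have hcn : 0 < (c ^ n)⁻¹ := inv_pos.2 (pow_pos hc n)
  refine ⟨‖c ^ n‖ₑ * ENNReal.ofReal (c ^ n)⁻¹ ^ (1 / p).toReal,
    mul_ne_zero (by simpa using fun h => absurd h hc.ne')
      (ENNReal.rpow_pos (ENNReal.ofReal_pos.2 hcn) ENNReal.ofReal_ne_top).ne',
    ENNReal.mul_ne_top enorm_ne_top (ENNReal.rpow_ne_top_of_nonneg ENNReal.toReal_nonneg
      ENNReal.ofReal_ne_top), fun F => ?_⟩
  rw [mul_assoc, ← eLpNorm_comp_smul _ hc, ← eLpNorm_const_smul]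
  refine eLpNorm_congr_norm_ae (Eventually.of_forall fun x => ?_)
  rw [fourierInv_dilate F hc]
  simp [norm_smul]

end FourierInv

/-! ### Bounded multipliers -/

/-- Schwartz functions with compactly supported Fourier transform. -/
def IsBandLimited (u : 𝓢(Rn n, CN N)) : Prop := ∃ R : ℝ, ∀ η, 𝓕 u η ≠ 0 → ‖η‖ ≤ R

theorem continuous_mulVec_rescale {m : Rn n → Matrix (Fin N) (Fin N) ℂ} (hm : Continuous m)
    {f : Rn n → CN N} (hf : Continuous f) :
    Continuous fun η => (WithLp.toLp 2 (rescale m η *ᵥ (f η).ofLp) : CN N) := by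
  refine (PiLp.continuous_toLp 2 _).comp (Continuous.matrix_mulVec (hm.comp (by fun_prop)) ?_)
  exact (PiLp.continuous_ofLp 2 _).comp hf

theorem exists_entry_le_of_norm_le {m : Rn n → Matrix (Fin N) (Fin N) ℂ} (hm : Continuous m)
    (R : ℝ) : ∃ C, ∀ η, ‖η‖ ≤ R → ∀ i j, ‖rescale m η i j‖ ≤ C := by
  have h : ∀ i j, ∃ C, ∀ η ∈ Metric.closedBall (0 : Rn n) R, ‖rescale m η i j‖ ≤ C :=
    fun i j => (isCompact_closedBall (0 : Rn n) R).exists_bound_of_continuousOn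
      (Continuous.continuousOn (Continuous.matrix_elem (hm.comp (by fun_prop)) i j))
  choose C hC using h
  refine ⟨∑ i, ∑ j, |C i j|, fun η hη i j =>
    (hC i j η (by simpa using hη)).trans ((le_abs_self _).trans ?_)⟩
  calc |C i j| ≤ ∑ j, |C i j| :=
        Finset.single_le_sum (f := fun j => |C i j|) (fun _ _ => abs_nonneg _) (Finset.mem_univ j)
    _ ≤ _ := Finset.single_le_sum (f := fun i => ∑ j, |C i j|)
        (fun _ _ => Finset.sum_nonneg fun _ _ => abs_nonneg _) (Finset.mem_univ i)

theorem fourierInv_smul_const (g : 𝓢(Rn n, ℂ)) (w : CN N) (x : Rn n) :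
    𝓕⁻ (fun η => g η • w) x = (𝓕⁻ g : 𝓢(Rn n, ℂ)) x • w := by
  rw [SchwartzMap.fourierInv_coe, Real.fourierInv_eq, Real.fourierInv_eq, ← integral_smul_const]
  refine integral_congr_ae (Eventually.of_forall fun η => ?_)
  simp only [Circle.smul_def, smul_assoc]

theorem eLpNorm_fourierInv_smul_const (g : 𝓢(Rn n, ℂ)) (w : CN N) :
    eLpNorm (𝓕⁻ fun η => g η • w) p = ‖w‖ₑ * eLpNorm (𝓕⁻ g : 𝓢(Rn n, ℂ)) p := by
  have h : ‖w‖ₑ = ‖((‖w‖ : ℝ) : ℂ)‖ₑ := by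
    rw [← enorm_norm, ← enorm_norm ((‖w‖ : ℝ) : ℂ), Complex.norm_real, norm_norm]
  rw [h, ← eLpNorm_const_smul]
  refine eLpNorm_congr_norm_ae (Eventually.of_forall fun x => ?_)
  rw [fourierInv_smul_const]
  simp [norm_smul, mul_comm]

theorem eLpNorm_fourierInv_ne_zero (hp : p ≠ 0) {g : 𝓢(Rn n, ℂ)} (hg : g ≠ 0) :
    eLpNorm (𝓕⁻ g : 𝓢(Rn n, ℂ)) p ≠ 0 := by
  intro h
  rw [eLpNorm_eq_zero_iff (SchwartzMap.continuous _).aestronglyMeasurable hp,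
    Continuous.ae_eq_iff_eq volume (SchwartzMap.continuous _) continuous_zero] at h
  have h1 : (𝓕⁻ g : 𝓢(Rn n, ℂ)) = 0 := DFunLike.coe_injective h
  apply hg
  rw [← FourierTransform.fourier_fourierInv_eq (F := 𝓢(Rn n, ℂ)) g, h1]
  exact map_zero (FourierTransform.fourierCLM ℂ 𝓢(Rn n, ℂ))

/-- The localized test function `𝓕⁻¹ (χ(ε⁻¹ (· - η₀)) v)`. -/
theorem exists_fourier_eq_dilate {g : Rn n → ℂ} (hg : IsTestFun g) {c : ℝ} (hc : 0 < c)
    (η₀ : Rn n) (v : CN N) : ∃ u : 𝓢(Rn n, CN N), IsBandLimited u ∧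
      (∀ η, 𝓕 u η = g (c⁻¹ • (η - η₀)) • v) ∧ ⇑u = 𝓕⁻ fun η => g (c⁻¹ • (η - η₀)) • v := by
  have h1 : HasCompactSupport fun η => g (c⁻¹ • (η - η₀)) • v := by
    have h2 : HasCompactSupport fun η => g (c⁻¹ • (η - η₀)) :=
      (hg.comp_smul (inv_ne_zero hc.ne')).compact.comp_homeomorph (Homeomorph.subRight η₀)
    exact h2.smul_right
  have h2 : ContDiff ℝ ∞ fun η => g (c⁻¹ • (η - η₀)) • v := by
    have := hg.contDiff
    fun_prop
  have h3 : 𝓕 (𝓕⁻ (h1.toSchwartzMap h2)) = h1.toSchwartzMap h2 :=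
    FourierTransform.fourier_fourierInv_eq _
  have h4 : ∀ η, 𝓕 (𝓕⁻ (h1.toSchwartzMap h2)) η = g (c⁻¹ • (η - η₀)) • v := fun η => by
    rw [h3]; rfl
  refine ⟨𝓕⁻ (h1.toSchwartzMap h2), ?_, h4, ?_⟩
  · obtain ⟨R, hR⟩ := h1.isCompact.isBounded.exists_norm_le
    exact ⟨R, fun η hη => hR η (subset_tsupport _ (by rwa [h4] at hη))⟩
  · rw [SchwartzMap.fourierInv_coe]; rfl

/-- The test functions have Fourier transform a bump of width `ε` around `η₀` times `v`. After
rescaling, the symbol seen is `m(η₀ + ε ·)`, which tends to a constant matrix as `ε → 0`. The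
limiting inequality has the same nonzero finite norm of a scalar function on both sides, and this
cancels. -/
theorem norm_mulVec_le_of_eLpNorm_le (hp0 : p ≠ 0) {m : Rn n → Matrix (Fin N) (Fin N) ℂ}
    (hm : Continuous m) {c : ℝ}
    (h : ∀ u : 𝓢(Rn n, CN N), IsBandLimited u →
      eLpNorm (multiplierOp m u) p ≤ ENNReal.ofReal c * eLpNorm u p) (η₀ : Rn n) (v : CN N) :
    ‖(WithLp.toLp 2 (rescale m η₀ *ᵥ v.ofLp) : CN N)‖ₑ ≤ ENNReal.ofReal c * ‖v‖ₑ := by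
  have hg := isTestFun_bump n
  set G : 𝓢(Rn n, ℂ) := hg.toSchwartz with hG
  have hG1 : ∀ η, G η = ((bump n η : ℝ) : ℂ) := fun η => rfl
  have hG0 : G ≠ 0 := by
    intro h0
    have h1 : G 0 = 0 := by rw [h0]; rfl
    rw [hG1, (bump n).one_of_mem_closedBall (by simp [bump])] at h1
    simp at h1
  set F : ℝ → Rn n → CN N := fun ε ζ =>
    WithLp.toLp 2 (rescale m (η₀ + ε • ζ) *ᵥ (G ζ • v).ofLp) with hF
  have hFc : ∀ ε, Continuous (F ε) := fun ε => by
    refine (PiLp.continuous_toLp 2 _).comp (Continuous.matrix_mulVec (hm.comp (by fun_prop)) ?_)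
    exact (PiLp.continuous_ofLp 2 _).comp (G.continuous.smul continuous_const)
  have hbound : ∀ ε : ℝ, 0 < ε → eLpNorm (𝓕⁻ (F ε)) p ≤
      ENNReal.ofReal c * eLpNorm (𝓕⁻ fun ζ => G ζ • v) p := by
    intro ε hε
    obtain ⟨K, hK0, hK, hKF⟩ := exists_eLpNorm_fourierInv_dilate n (CN N) p hε η₀
    obtain ⟨u, hu, hu1, hu2⟩ := exists_fourier_eq_dilate hg hε η₀ v
    have h1 : multiplierOp m u = 𝓕⁻ fun η => F ε (ε⁻¹ • (η - η₀)) := by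
      rw [multiplierOp]
      congr 1
      funext η
      rw [hu1, hF]
      beta_reduce
      rw [smul_inv_smul₀ hε.ne', add_sub_cancel]
      rfl
    have h2 := h u hu
    rw [h1, hu2, hKF, show (fun η => ((bump n (ε⁻¹ • (η - η₀)) : ℝ) : ℂ) • v) =
      fun η => (fun ζ => G ζ • v) (ε⁻¹ • (η - η₀)) from rfl,
      hKF fun ζ => G ζ • v, mul_left_comm] at h2
    exact (ENNReal.mul_le_mul_iff_right hK0 hK).1 h2
  -- The bump is supported in the ball of radius `2` and only `ε ≤ 1` occurs, so all arguments `η₀ +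
  -- ε ζ` stay in this ball.
  obtain ⟨C, hC⟩ := exists_entry_le_of_norm_le hm (‖η₀‖ + 2)
  have hlim : eLpNorm (𝓕⁻ (F 0)) p ≤ ENNReal.ofReal c * eLpNorm (𝓕⁻ fun ζ => G ζ • v) p := by
    refine eLpNorm_fourierInv_le_of_tendsto (f := fun k : ℕ => F (1 / ((k : ℝ) + 1)))
      (b := fun ζ => (N * (N * C)) * (‖G ζ‖ * ‖v‖)) (fun k => (hFc _).aestronglyMeasurable)
      (((G.integrable (μ := volume)).norm.mul_const _).const_mul _) (fun k ζ => ?_) (fun ζ => ?_)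
      (fun k => hbound _ (by positivity)) tendsto_const_nhds
    · rw [← norm_smul]
      by_cases hζ : G ζ = 0
      · simp [hF, hζ]
      · refine norm_toLp_mulVec_le (hC _ ?_) _
        have h2 : ‖ζ‖ ≤ 2 := by
          by_contra! h2
          refine hζ ?_
          rw [hG1, (bump n).zero_of_le_dist (by simpa [bump] using h2.le)]
          simp
        refine (norm_add_le _ _).trans (add_le_add_right ?_ _)
        rw [norm_smul, Real.norm_of_nonneg (by positivity)]
        have : 1 / ((k : ℝ) + 1) ≤ 1 := by
          rw [div_le_one (by positivity)]
          linarith [(Nat.cast_nonneg k : (0 : ℝ) ≤ k)]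
        nlinarith [norm_nonneg ζ]
    · have h1 : Continuous fun ε => F ε ζ := by
        refine (PiLp.continuous_toLp 2 _).comp
          (Continuous.matrix_mulVec (hm.comp (by fun_prop)) continuous_const)
      exact (h1.tendsto 0).comp tendsto_one_div_add_atTop_nhds_zero_nat
  have hF0 : F 0 = fun ζ => G ζ • (WithLp.toLp 2 (rescale m η₀ *ᵥ v.ofLp) : CN N) := by
    funext ζ
    simp only [hF, zero_smul, add_zero, WithLp.ofLp_smul, Matrix.mulVec_smul, WithLp.toLp_smul]
  rw [hF0, eLpNorm_fourierInv_smul_const, eLpNorm_fourierInv_smul_const, ← mul_assoc] at hlim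
  refine (ENNReal.mul_le_mul_iff_left (eLpNorm_fourierInv_ne_zero hp0 hG0) ?_).1 hlim
  exact ((𝓕⁻ G).memLp p volume).2.ne

theorem norm_entry_le_of_eLpNorm_le (hp0 : p ≠ 0) {m : Rn n → Matrix (Fin N) (Fin N) ℂ}
    (hm : Continuous m) {c : ℝ} (hc : 0 ≤ c)
    (h : ∀ u : 𝓢(Rn n, CN N), IsBandLimited u →
      eLpNorm (multiplierOp m u) p ≤ ENNReal.ofReal c * eLpNorm u p) (ξ : Rn n) (i j : Fin N) :
    ‖m ξ i j‖ ≤ c := by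
  have hξ : rescale m ((-(2 * Real.pi))⁻¹ • ξ) = m ξ := by
    rw [rescale, smul_inv_smul₀ (neg_ne_zero.2 Real.two_pi_pos.ne')]
  have h1 := norm_mulVec_le_of_eLpNorm_le hp0 hm h ((-(2 * Real.pi))⁻¹ • ξ)
    (EuclideanSpace.single j 1)
  rw [hξ, ← ofReal_norm, ← ofReal_norm, ← ENNReal.ofReal_mul hc,
    ENNReal.ofReal_le_ofReal_iff (by positivity)] at h1
  have h2 := PiLp.norm_apply_le
    (WithLp.toLp 2 (m ξ *ᵥ (EuclideanSpace.single j (1 : ℂ)).ofLp) : CN N) i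
  simpa using h2.trans h1

end BandLimited

/-! ### From uniform bounds for the truncated exponentials to multiplier bounds and back. -/

section WellPosedness

open Filter Topology

variable {n N : ℕ} {p : ℝ≥0∞}

/-! ### Frequency cutoffs of vector-valued Schwartz functions -/

/-- The frequency cutoff `op[χ_k] u`. -/
def freqCut (k : ℕ) (u : 𝓢(Rn n, CN N)) : 𝓢(Rn n, CN N) :=
  SchwartzMap.fourierMultiplierCLM (CN N) (rescale (cutoff n k)) u

theorem hasTemperateGrowth_rescale_cutoff (n k : ℕ) :
    (rescale (cutoff n k)).HasTemperateGrowth :=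
  (isTestFun_cutoff n k).rescale.hasTemperateGrowth

theorem fourier_freqCut (k : ℕ) (u : 𝓢(Rn n, CN N)) (η : Rn n) :
    𝓕 (freqCut k u) η = rescale (cutoff n k) η • 𝓕 u η := by
  rw [freqCut, SchwartzMap.fourierMultiplierCLM_apply,
    FourierTransform.fourier_fourierInv_eq (F := 𝓢(Rn n, CN N)),
    SchwartzMap.smulLeftCLM_apply_apply (hasTemperateGrowth_rescale_cutoff n k)]

theorem norm_rescale_cutoff_le (k : ℕ) (η : Rn n) : ‖rescale (cutoff n k) η‖ ≤ 1 :=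
  norm_cutoff_le k _

theorem norm_le_of_fourier_freqCut_ne_zero {k : ℕ} {u : 𝓢(Rn n, CN N)} {η : Rn n}
    (h : 𝓕 (freqCut k u) η ≠ 0) : ‖(-(2 * Real.pi)) • η‖ ≤ 2 ^ (k + 1) := by
  by_contra! h1
  refine h ?_
  rw [fourier_freqCut, rescale, cutoff_eq_zero h1.le, zero_smul]

theorem isBandLimited_freqCut (k : ℕ) (u : 𝓢(Rn n, CN N)) : IsBandLimited (freqCut k u) := by
  refine ⟨2 ^ (k + 1), fun η hη => le_trans ?_ (norm_le_of_fourier_freqCut_ne_zero hη)⟩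
  rw [norm_smul, norm_neg, Real.norm_of_nonneg Real.two_pi_pos.le]
  exact le_mul_of_one_le_left (norm_nonneg η) (by linarith [Real.pi_gt_three])

theorem IsBandLimited.exists_freqCut_eq {u : 𝓢(Rn n, CN N)} (hu : IsBandLimited u) :
    ∃ k, freqCut k u = u := by
  obtain ⟨R, hR⟩ := hu
  obtain ⟨k, hk⟩ := pow_unbounded_of_one_lt (2 * Real.pi * R) one_lt_two
  have hinj : Function.Injective fun φ : 𝓢(Rn n, CN N) => (𝓕 φ : 𝓢(Rn n, CN N)) :=
    Function.LeftInverse.injective (g := fun ψ : 𝓢(Rn n, CN N) => (𝓕⁻ ψ : 𝓢(Rn n, CN N)))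
      fun φ => FourierTransform.fourierInv_fourier_eq φ
  refine ⟨k, hinj (SchwartzMap.ext fun η => ?_)⟩
  beta_reduce
  rw [fourier_freqCut]
  by_cases h : 𝓕 u η = 0
  · rw [h, smul_zero]
  · rw [rescale, cutoff_eq_one, one_smul]
    rw [norm_smul, norm_neg, Real.norm_of_nonneg Real.two_pi_pos.le]
    exact (mul_le_mul_of_nonneg_left (hR η h) Real.two_pi_pos.le).trans hk.le

theorem tendsto_freqCut (u : 𝓢(Rn n, CN N)) : Tendsto (fun k => freqCut k u) atTop (𝓝 u) :=
  tendsto_fourierMultiplierCLM_cutoff u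

theorem conjugatedExp_truncatedSymbol {s : Fin N → ℝ} {a : Rn n → Matrix (Fin N) (Fin N) ℂ} {k : ℕ}
    (t : ℝ) {ξ : Rn n} (h : ‖ξ‖ ≤ 2 ^ (k + 1)) :
    conjugatedExp s (truncatedSymbol a k) t ξ = conjugatedExp s a t ξ := by
  rw [conjugatedExp, conjugatedExp, truncatedSymbol, cutoff_eq_one h, one_smul]

theorem multiplierOp_truncatedSymbol (s : Fin N → ℝ) (a : Rn n → Matrix (Fin N) (Fin N) ℂ) (k : ℕ)
    (t : ℝ) (u : 𝓢(Rn n, CN N)) :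
    multiplierOp (conjugatedExp s (truncatedSymbol a k) t) (freqCut k u) =
      multiplierOp (conjugatedExp s a t) (freqCut k u) :=
  multiplierOp_congr fun _ hη =>
    conjugatedExp_truncatedSymbol t (norm_le_of_fourier_freqCut_ne_zero hη)

/-! ### Extension of bounds from band-limited functions to the Schwartz space -/

theorem continuous_multiplierOp {m : Rn n → Matrix (Fin N) (Fin N) ℂ} (hm : Continuous m) {c : ℝ}
    (hc : ∀ ξ i j, ‖m ξ i j‖ ≤ c) (u : 𝓢(Rn n, CN N)) : Continuous (multiplierOp m u) :=
  continuous_fourierInv_of_integrable (integrable_symbol_mulVec hm fun _ _ => hc _)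

/-- The hypothesis is applied to the frequency cutoffs of `u`, which converge to `u` in `Lᵖ`. The
entrywise bound on `m` that it implies provides the integrable majorant on the Fourier side. -/
theorem isMultiplierBound_of_isBandLimited [Fact (1 ≤ p)] {m : Rn n → Matrix (Fin N) (Fin N) ℂ} (hm : Continuous m) {c : ℝ} (hc : 0 ≤ c)
    (h : ∀ u : 𝓢(Rn n, CN N), IsBandLimited u →
      eLpNorm (multiplierOp m u) p ≤ ENNReal.ofReal c * eLpNorm u p) :
    IsMultiplierBound p m c := by
  have hp1 : 1 ≤ p := Fact.out
  have hmc := norm_entry_le_of_eLpNorm_le (zero_lt_one.trans_le hp1).ne' hm hc h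
  have hu : ∀ u : 𝓢(Rn n, CN N),
      eLpNorm (multiplierOp m u) p ≤ ENNReal.ofReal c * eLpNorm u p := by
    intro u
    have hlim : Tendsto (fun k => eLpNorm (freqCut k u) p) atTop (𝓝 (eLpNorm u p)) := by
      have h1 := (((SchwartzMap.toLpCLM ℂ (CN N) p (volume : Measure (Rn n))).continuous.tendsto
        u).comp (tendsto_freqCut u)).norm
      have h2 := ENNReal.tendsto_ofReal h1
      have h3 : ∀ v : 𝓢(Rn n, CN N), ENNReal.ofReal
          ‖SchwartzMap.toLpCLM ℂ (CN N) p (volume : Measure (Rn n)) v‖ = eLpNorm v p := by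
        intro v
        rw [SchwartzMap.toLpCLM_apply, SchwartzMap.norm_toLp,
          ENNReal.ofReal_toReal (v.memLp p volume).2.ne]
      simpa only [h3, Function.comp_def] using h2
    refine eLpNorm_fourierInv_le_of_tendsto
      (f := fun k η => WithLp.toLp 2 (rescale m η *ᵥ (𝓕 (freqCut k u) η).ofLp))
      (b := fun η => (N * (N * c)) * ‖𝓕 u η‖)
      (fun k => (continuous_mulVec_rescale hm (SchwartzMap.continuous _)).aestronglyMeasurable)
      (((𝓕 u).integrable (μ := volume)).norm.const_mul _) (fun k η => ?_) (fun η => ?_)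
      (fun k => h _ (isBandLimited_freqCut k u))
      (ENNReal.Tendsto.const_mul hlim (Or.inr ENNReal.ofReal_ne_top))
    · refine (norm_toLp_mulVec_le (hmc _) _).trans ?_
      refine mul_le_mul_of_nonneg_left ?_ (by positivity)
      rw [fourier_freqCut, norm_smul]
      exact mul_le_of_le_one_left (norm_nonneg _) (norm_rescale_cutoff_le k η)
    · have h1 : Tendsto (fun k => 𝓕 (freqCut k u) η) atTop (𝓝 (𝓕 u η)) := by
        obtain ⟨k₀, hk₀⟩ := pow_unbounded_of_one_lt ‖(-(2 * Real.pi)) • η‖ one_lt_two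
        refine tendsto_const_nhds.congr' ?_
        filter_upwards [eventually_ge_atTop k₀] with k hk
        rw [fourier_freqCut, rescale,
          cutoff_eq_one (hk₀.le.trans (pow_le_pow_right₀ one_le_two hk)), one_smul]
      have h4 : Continuous fun v : CN N => (WithLp.toLp 2 (rescale m η *ᵥ v.ofLp) : CN N) :=
        (PiLp.continuous_toLp 2 _).comp
          (Continuous.matrix_mulVec continuous_const (PiLp.continuous_ofLp 2 _))
      exact (h4.tendsto _).comp h1
  refine ⟨hc, fun u => ⟨⟨(continuous_multiplierOp hm hmc u).aestronglyMeasurable, ?_⟩, hu u⟩⟩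
  exact (hu u).trans_lt (ENNReal.mul_lt_top ENNReal.ofReal_lt_top (u.memLp p volume).2)

theorem isMultiplier_and_multiplierNorm_le [Fact (1 ≤ p)] {m : Rn n → Matrix (Fin N) (Fin N) ℂ} (hm : Continuous m) {c : ℝ} (hc : 0 ≤ c)
    (h : ∀ u : 𝓢(Rn n, CN N), IsBandLimited u →
      eLpNorm (multiplierOp m u) p ≤ ENNReal.ofReal c * eLpNorm u p) :
    IsMultiplier p m ∧ multiplierNorm p m ≤ c := by
  have hp1 : 1 ≤ p := Fact.out
  have hb := isMultiplierBound_of_isBandLimited hm hc h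
  have hmc := norm_entry_le_of_eLpNorm_le (zero_lt_one.trans_le hp1).ne' hm hc h
  refine ⟨⟨fun i j => memLp_top_of_bound (hm.matrix_elem i j).aestronglyMeasurable c
    (Eventually.of_forall fun ξ => hmc ξ i j), c, hb⟩, csInf_le ⟨0, ?_⟩ hb⟩
  exact fun c hc => hc.1

/-- The strict inequality avoids having to show that the infimum is attained. -/
theorem IsMultiplier.isMultiplierBound {m : Rn n → Matrix (Fin N) (Fin N) ℂ}
    (hm : IsMultiplier p m) {c : ℝ} (hc : multiplierNorm p m < c) : IsMultiplierBound p m c := by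
  obtain ⟨b, hb, hbc⟩ := exists_lt_of_csInf_lt hm.2 hc
  refine ⟨hb.1.trans hbc.le, fun u => ⟨(hb.2 u).1, (hb.2 u).2.trans ?_⟩⟩
  gcongr

/-! ### Comparison of norms -/

variable [Fact (1 ≤ p)] {s : Fin N → ℝ}

theorem memLp_of_toLp_eq {x : BesselProd n p s} {F : Rn n → CN N}
    (h : ∀ i, (BesselSpace.toLp (x i) : Rn n → ℂ) =ᵐ[volume] fun y => F y i) : MemLp F p :=
  MemLp.of_eval_piLp fun i => (Lp.memLp _).ae_eq (h i)

theorem norm_le_of_toLp_eq {x : BesselProd n p s} {F : Rn n → CN N}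
    (h : ∀ i, (BesselSpace.toLp (x i) : Rn n → ℂ) =ᵐ[volume] fun y => F y i) :
    ‖x‖ ≤ (eLpNorm F p).toReal := by
  refine (pi_norm_le_iff_of_nonneg ENNReal.toReal_nonneg).2 fun i => ?_
  rw [BesselSpace.norm_eq, Lp.norm_def, eLpNorm_congr_ae (h i)]
  exact ENNReal.toReal_mono (memLp_of_toLp_eq h).2.ne
    (eLpNorm_mono fun y => PiLp.norm_apply_le (F y) i)

/-- The norm of `X` is a maximum over components, whereas multipliers act on functions with
Euclidean values; the triangle inequality costs the factor `N`. -/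
theorem eLpNorm_le_of_toLp_eq {x : BesselProd n p s} {F : Rn n → CN N}
    (h : ∀ i, (BesselSpace.toLp (x i) : Rn n → ℂ) =ᵐ[volume] fun y => F y i) :
    eLpNorm F p ≤ ENNReal.ofReal (N * ‖x‖) := by
  have hmeas : ∀ i, AEStronglyMeasurable fun y => ‖F y i‖ := fun i =>
    ((Lp.memLp (BesselSpace.toLp (x i))).ae_eq (h i)).1.norm
  have h0 : ∀ i, eLpNorm (fun y => ‖F y i‖) p ≤ ENNReal.ofReal ‖x‖ := fun i => by
    have h1 := norm_le_pi_norm x i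
    rw [BesselSpace.norm_eq, Lp.norm_def, eLpNorm_congr_ae (h i)] at h1
    rw [eLpNorm_norm]
    exact (ENNReal.le_ofReal_iff_toReal_le ((Lp.memLp _).ae_eq (h i)).2.ne (norm_nonneg x)).2 h1
  have h1 : eLpNorm F p ≤ eLpNorm (∑ i, fun y => ‖F y i‖) p :=
    eLpNorm_mono_real fun y => by
      rw [Finset.sum_apply]
      exact norm_le_sum_norm (F y)
  have h2 : eLpNorm (∑ i, fun y => ‖F y i‖) p ≤ ∑ i, eLpNorm (fun y => ‖F y i‖) p :=
    eLpNorm_sum_le (fun i _ => hmeas i) Fact.out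
  refine (h1.trans h2).trans ((Finset.sum_le_sum fun i _ => h0 i).trans_eq ?_)
  rw [Finset.sum_const, Finset.card_univ, Fintype.card_fin, nsmul_eq_mul,
    ENNReal.ofReal_mul (Nat.cast_nonneg N), ENNReal.ofReal_natCast]

/-! ### Bounds for the truncated exponentials and multiplier bounds -/

/-- `Λ⁻¹ u` as an element of `∏ⱼ H_p^{sⱼ}`, for `u` in the Schwartz space. -/
def embedVec (p : ℝ≥0∞) [Fact (1 ≤ p)] (s : Fin N → ℝ) (u : 𝓢(Rn n, CN N)) : BesselProd n p s :=
  embed p s fun j => coord j u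

theorem toLp_embedVec (u : 𝓢(Rn n, CN N)) (i : Fin N) :
    (BesselSpace.toLp (embedVec p s u i) : Rn n → ℂ) =ᵐ[volume] fun y => u y i := by
  rw [embedVec, toLp_embed]
  exact (coord i u).coeFn_toLp p volume

theorem opProd_cutoffMatrix_embedVec (hp : p ≠ ⊤) (k : ℕ) (u : 𝓢(Rn n, CN N)) :
    opProd p s (cutoffMatrix n N k) (embedVec p s u) = embedVec p s (freqCut k u) := by
  funext i
  apply BesselSpace.toLp_injective
  rw [toLp_opProd_cutoffMatrix hp, embedVec, embedVec, toLp_embed, toLp_embed,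
    opLp_toLp hp (isTestFun_cutoff n k), freqCut,
    coord_fourierMultiplierCLM (hasTemperateGrowth_rescale_cutoff n k)]

theorem denseRange_embedVec (hp : p ≠ ⊤) : DenseRange (embedVec (n := n) p s) := by
  have h : DenseRange (Pi.map fun (j : Fin N) (φ : 𝓢(Rn n, ℂ)) =>
      (BesselSpace.toLpEquiv (s := s j)).symm (φ.toLp p (volume : Measure (Rn n)))) :=
    DenseRange.piMap fun j =>
      (BesselSpace.toLpEquiv (s := s j)).symm.surjective.denseRange.comp (denseRange_toLp hp)
        (BesselSpace.toLpEquiv (s := s j)).symm.continuous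
  refine h.mono ?_
  rintro _ ⟨Φ, rfl⟩
  refine ⟨∑ j, SchwartzMap.postcompCLM
    ((ContinuousLinearMap.id ℂ ℂ).smulRight (EuclideanSpace.single j (1 : ℂ) : CN N)) (Φ j), ?_⟩
  rw [embedVec]
  refine congrArg (embed p s) (funext fun i => ?_)
  ext x
  rw [coord_apply]
  simp [Pi.single_apply]

theorem toLp_exp_opProd_truncatedSymbol (hp : p ≠ ⊤) {μ : ℝ}
    {a : Rn n → Matrix (Fin N) (Fin N) ℂ} (ha : IsMatrixSymbol μ a) (t : ℝ) (k : ℕ)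
    (u : 𝓢(Rn n, CN N)) (i : Fin N) :
    (BesselSpace.toLp (NormedSpace.exp ((t : ℂ) • opProd p s (truncatedSymbol a k))
      (opProd p s (cutoffMatrix n N k) (embedVec p s u)) i) : Rn n → ℂ) =ᵐ[volume]
      fun x => multiplierOp (conjugatedExp s a t) (freqCut k u) x i := by
  rw [opProd_cutoffMatrix_embedVec hp, ← multiplierOp_truncatedSymbol]
  exact toLp_exp_opProd hp s (ha.isMatrixTestFun_truncatedSymbol k) t _ i

theorem IsMatrixSymbol.continuous {μ : ℝ} {a : Rn n → Matrix (Fin N) (Fin N) ℂ}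
    (ha : IsMatrixSymbol μ a) : Continuous a :=
  continuous_matrix fun i j => (ha i j).1.continuous

/-- A band-limited function equals its own cutoff for some `k`. As the assumed bound is uniform in
`k`, the value of this `k` is irrelevant. -/
theorem eLpNorm_multiplierOp_le_of_exp_bound (hp : p ≠ ⊤) {μ : ℝ}
    {a : Rn n → Matrix (Fin N) (Fin N) ℂ} (ha : IsMatrixSymbol μ a) {t C : ℝ} (hC : 0 ≤ C)
    (h : ∀ k x, ‖NormedSpace.exp ((t : ℂ) • opProd p s (truncatedSymbol a k))
      (opProd p s (cutoffMatrix n N k) x)‖ ≤ C * ‖x‖) {u : 𝓢(Rn n, CN N)} (hu : IsBandLimited u) :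
    eLpNorm (multiplierOp (conjugatedExp s a t) u) p ≤ ENNReal.ofReal (N * C) * eLpNorm u p := by
  obtain ⟨k, hk⟩ := hu.exists_freqCut_eq
  have h1 := eLpNorm_le_of_toLp_eq (toLp_exp_opProd_truncatedSymbol (s := s) hp ha t k u)
  rw [hk] at h1
  refine h1.trans ?_
  rw [← ENNReal.ofReal_toReal (u.memLp p volume).2.ne, ← ENNReal.ofReal_mul (by positivity),
    mul_assoc]
  gcongr
  refine (h k _).trans ?_
  gcongr
  exact norm_le_of_toLp_eq (toLp_embedVec u)

theorem exp_bound_of_isMultiplierBound (hp : p ≠ ⊤) {μ : ℝ}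
    {a : Rn n → Matrix (Fin N) (Fin N) ℂ} (ha : IsMatrixSymbol μ a) {t C : ℝ}
    (h : IsMultiplierBound p (conjugatedExp s a t) C) (k : ℕ) (x : BesselProd n p s) :
    ‖NormedSpace.exp ((t : ℂ) • opProd p s (truncatedSymbol a k))
      (opProd p s (cutoffMatrix n N k) x)‖ ≤ C * (N * ‖opProd p s (cutoffMatrix n N k) x‖) := by
  induction x using (denseRange_embedVec (n := n) (s := s) hp).induction_on with
  -- Both sides are continuous in `x` for fixed `k`, so it suffices to treat the dense set `Λ⁻¹ 𝓢`.
  | hp => exact isClosed_le (by fun_prop) (by fun_prop)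
  | ih u =>
    refine (norm_le_of_toLp_eq (toLp_exp_opProd_truncatedSymbol hp ha t k u)).trans ?_
    refine (ENNReal.toReal_mono ?_ (h.2 (freqCut k u)).2).trans ?_
    · exact ENNReal.mul_ne_top ENNReal.ofReal_ne_top ((freqCut k u).memLp p volume).2.ne
    rw [ENNReal.toReal_mul, ENNReal.toReal_ofReal h.1, opProd_cutoffMatrix_embedVec hp]
    refine mul_le_mul_of_nonneg_left ?_ h.1
    exact ENNReal.toReal_le_of_le_ofReal (by positivity)
      (eLpNorm_le_of_toLp_eq (toLp_embedVec (freqCut k u)))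

theorem isWellPosed_realization_iff (hp : p ≠ ⊤) {μ : ℝ} {a : Rn n → Matrix (Fin N) (Fin N) ℂ}
    (ha : IsMatrixSymbol μ a) (s : Fin N → ℝ) :
    IsWellPosed (realization p s a) ↔ ∀ T : ℝ, 0 ≤ T → ∃ C : ℝ, 0 < C ∧ ∀ t ∈ Icc 0 T,
      IsMultiplier p (conjugatedExp s a t) ∧ multiplierNorm p (conjugatedExp s a t) ≤ C := by
  have htr := isTruncation_realization hp s ha
  rw [htr.isWellPosed_iff_exp_bound (realization_isClosed p s a) (realization_dense hp s ha)]
  refine forall₂_congr fun T _ => ⟨?_, ?_⟩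
  · rintro ⟨C, hC, h⟩
    -- The summand `1` keeps the constant positive when `N = 0`.
    refine ⟨N * C + 1, by positivity, fun t ht => ?_⟩
    have h1 := isMultiplier_and_multiplierNorm_le (continuous_conjugatedExp s ha.continuous t)
      (by positivity) fun u hu => eLpNorm_multiplierOp_le_of_exp_bound hp ha hC.le (h t ht) hu
    exact ⟨h1.1, h1.2.trans (by linarith)⟩
  · rintro ⟨C, hC, h⟩
    obtain ⟨D, hD, hPD⟩ := htr.exists_norm_le
    refine ⟨(C + 1) * (N * D) + 1, by positivity, fun t ht k x => ?_⟩
    -- `C + 1` lies strictly above the multiplier norm, hence is an actual bound.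
    have hb := (h t ht).1.isMultiplierBound (c := C + 1) (by linarith [(h t ht).2])
    refine (exp_bound_of_isMultiplierBound hp ha hb k x).trans ?_
    have h1 : ‖opProd p s (cutoffMatrix n N k) x‖ ≤ D * ‖x‖ :=
      ContinuousLinearMap.le_of_opNorm_le _ (hPD k) x
    calc (C + 1) * (N * ‖opProd p s (cutoffMatrix n N k) x‖) ≤ (C + 1) * (N * (D * ‖x‖)) := by
          gcongr
      _ ≤ _ := by linarith [norm_nonneg x]

/-- The entries of `Λ a Λ⁻¹` involve the orders only through the differences `s i - s j`. -/
theorem conjugatedExp_add_const (s : Fin N → ℝ) (r : ℝ) (a : Rn n → Matrix (Fin N) (Fin N) ℂ)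
    (t : ℝ) : conjugatedExp (fun j => s j + r) a t = conjugatedExp s a t := by
  funext ξ
  rw [conjugatedExp_eq_exp, conjugatedExp_eq_exp]
  congr 2
  ext i j
  rw [conjSymbol_apply, conjSymbol_apply, ← Complex.ofReal_mul, ← Complex.ofReal_mul,
    ← Real.rpow_add (bracket_pos ξ), ← Real.rpow_add (bracket_pos ξ)]
  ring_nf

end WellPosedness

end MixedOrder

end

/-! ### Equivalence of well-posedness, multiplier bounds and well-posedness at all shifted orders.
-/

theorem corollary2p9 (n N : ℕ) (p : ℝ≥0∞) [Fact (1 ≤ p)] (hp_one : 1 < p) (hp_top : p < ⊤)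
    (μ : ℝ) (a : MixedOrder.Rn n → Matrix (Fin N) (Fin N) ℂ)
    (ha : MixedOrder.IsMatrixSymbol μ a) (hqh : MixedOrder.IsQuasiHyperbolic a)
    (s : Fin N → ℝ) :
    List.TFAE
      [ MixedOrder.IsWellPosed (MixedOrder.realization p s a),
        ∀ T : ℝ, 0 ≤ T → ∃ C : ℝ, 0 < C ∧ ∀ t ∈ Set.Icc 0 T,
          MixedOrder.IsMultiplier p (MixedOrder.conjugatedExp s a t) ∧
            MixedOrder.multiplierNorm p (MixedOrder.conjugatedExp s a t) ≤ C,
        ∀ r : ℝ, MixedOrder.IsWellPosed (MixedOrder.realization p (fun j => s j + r) a) ] := by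
  have h := MixedOrder.isWellPosed_realization_iff hp_top.ne ha
  tfae_have 1 ↔ 2 := h s
  tfae_have 2 → 3 := fun h2 r => by
    rw [h]
    simpa only [MixedOrder.conjugatedExp_add_const] using h2
  tfae_have 3 → 2 := fun h3 => by
    simpa only [MixedOrder.conjugatedExp_add_const] using (h _).1 (h3 0)
  tfae_finish
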